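/- Let $\prec$ be a (strict) well-order on $\mathbb{N}$ and let $|{\prec}|$ be its order type. **Language and formulae.** Let $\mathcal{L}_{\mathbb{N}}$ be the first-order language having a symbol for every function $\mathbb{N}^n\to\mathbb{N}$ and every predicate on $\mathbb{N}^n$ (in particular $=$, $\le$, $\prec$), and $\mathcal{L}_{\mathbb{N}}(X)$ its extension by a fresh unary predicate symbol $X$ (we write $t\in X$ for $X(t)$). Formulae are in negation normal form, built from literals by $\land,\lor,\forall,\exists$, and are identified up to renaming of bound variables; $\overline{\varphi}$ is the negation normal form of $\lnot\varphi$, and $fv$ denotes the set of free variables. $\Delta_0(X)$ is the class of bounded formulae (the quantifiers $\exists x\le t$, $\forall x\le t$ abbreviate $\exists x(x\le t\land\cdot)$, $\forall x(\lnot\, x\le t\lor\cdot)$). $p\Sigma_i(X)$ is the class of formulae $\exists x_1\forall x_2\cdots\,\psi$ with exactly $i$ alternating quantifiers, where $\psi$ is a maximal $\Delta_0(X)$-subformula; $p\Sigma_i$ consists of those without $X$. $Th(\mathbb{N})$ is the set of all $\mathcal{L}_{\mathbb{N}}$-sentences in $\bigcup_i p\Sigma_i$ true in $\mathbb{N}$,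 and $I\Sigma_k(X)$ is the theory consisting of $Th(\mathbb{N})$ and of the (universal closures of the) induction axioms $(\varphi(0)\land\forall x(\varphi(x)\to\varphi(x+1)))\to\forall x\,\varphi(x)$ for $\varphi\in p\Sigma_k(X)$. A sequent is a finite set of formulae, read as the universal closure of its disjunction; $\Gamma,\varphi$ stands for $\Gamma\cup\{\varphi\}$. Let $$TI(\prec):=\{\forall y\;\overline{y\in X},\ \ \exists x_0\forall x\,(x_0\in X\land(\overline{x\in X}\lor\overline{x\prec x_0}))\}.$$ **Derivations.** A derivation $\pi=(\tau,\lambda)\colon I\Sigma_k(X)\vdash S$ (in free variable normal form without redundancy) is a finite nonempty set $\tau$ of finite sequences of natural numbers closed under initial segments, with a map $\lambda$ from $\tau$ to sequents such that $\lambda(\emptyset)=S$ and each $\lambda(v)$ is obtained from the labels of the children of $v$ (from left to right) by one of the following rules, whose conclusion is $\Gamma$: * Initial sequent: no premise, where $L,\overline{L}\in\Gamma$ for a literal $L$. * $\lor$: premise $\Gamma,\varphi_i$, where $\varphi_1\lor\varphi_2\in\Gamma$, $i\in\{1,2\}$, $\varphi_i\notin\Gamma$. * $\land$: premises $\Gamma,\varphi_1$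 and $\Gamma,\varphi_2$, where $\varphi_1\land\varphi_2\in\Gamma$ and $\varphi_1,\varphi_2\notin\Gamma$. * $\exists$: premise $\Gamma,\varphi(u)$, where $\exists x\,\varphi(x)\in\Gamma$, $u$ is a term whose variables lie in $fv(\Gamma\cup\{\varphi(u)\})=fv(\Gamma)$, and $\varphi(u)\notin\Gamma$. * $\forall$: premise $\Gamma,\varphi(a)$, where $\forall x\,\varphi(x)\in\Gamma$, $a\notin fv(\Gamma)$, $\varphi(a)\notin\Gamma$ and $fv(\Gamma\cup\{\varphi(a)\})\subseteq fv(\Gamma)\cup\{a\}$. * True sentence: premise $\Gamma,\overline{\varphi}$, where $\varphi\in Th(\mathbb{N})$ and $\overline{\varphi}\notin\Gamma$. * $p\Sigma_k(X)$-induction: premises $\Gamma,\varphi(0)$; $\ \Gamma,\overline{\varphi(a)},\varphi(a+1)$; $\ \Gamma,\overline{\varphi(t)}$, where $\varphi(x)\in p\Sigma_k(X)$, $t$ is a term whose variables lie in $fv(\varphi(t))$, $\varphi(0)\notin\Gamma$, the formulae $\varphi(t)$ and $\overline{\varphi(t)}$ are not both in $\Gamma$, $a\notin fv(\Gamma\cup\{\varphi(0)\})=fv(\Gamma\cup\{\overline{\varphi(t)}\})=fv(\Gamma)$,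 and $fv(\Gamma\cup\{\overline{\varphi(a)},\varphi(a+1)\})=fv(\Gamma)\cup\{a\}$. * $p\Sigma_k(X)$-cut: premises $\Gamma,\varphi$ and $\Gamma,\overline{\varphi}$, where $\varphi\in p\Sigma_k(X)$, $\varphi,\overline{\varphi}\notin\Gamma$ and $fv(\Gamma\cup\{\varphi\})=fv(\Gamma\cup\{\overline{\varphi}\})=fv(\Gamma)$. The height of $\pi$, $height(\pi)$, is the maximal length of a sequence in $\tau$. **Statement.** For every $h\in\mathbb{N}$: if $\pi\colon I\Sigma_1(X)\vdash TI(\prec)$ and $|{\prec}|>\omega^{h+1}+\omega$, then $height(\pi)>h$. In particular, if $|{\prec}|\ge\omega^{\omega}$, then $I\Sigma_1(X)$ does not prove $TI(\prec)$: there is no derivation $\pi\colon I\Sigma_1(X)\vdash TI(\prec)$, and $TI(\prec)$ is not a consequence of the theory $I\Sigma_1(X)$ in first-order logic with equality. -/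

import Mathlib

namespace ArithX

/-- The language whose function and predicate symbols are all functions and all predicates
on the natural numbers, of every finite arity. -/
def LN : FirstOrder.Language.{0, 0} where
  Functions n := (Fin n → ℕ) → ℕ
  Relations n := (Fin n → ℕ) → Prop

/-- The standard model. -/
instance : LN.Structure ℕ where
  funMap f x := f x
  RelMap R x := R x

/-- Terms with free variables in `ℕ`, in the scope of `n` quantifiers; the variables bound by
these quantifiers are `Sum.inr 0, …, Sum.inr (n - 1)`, the outermost quantifier first. -/
abbrev Tm (n : ℕ) : Type := LN.Term (ℕ ⊕ Fin n)

/-- The free variable `a`. -/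
def fvar {n : ℕ} (a : ℕ) : Tm n := FirstOrder.Language.Term.var (Sum.inl a)

/-- A variable bound by one of the surrounding quantifiers. -/
def bvar {n : ℕ} (i : Fin n) : Tm n := FirstOrder.Language.Term.var (Sum.inr i)

/-- The numeral for zero. -/
def tzero {n : ℕ} : Tm n :=
  FirstOrder.Language.Term.func ((fun _ => 0 : (Fin 0 → ℕ) → ℕ) : LN.Functions 0) ![]

/-- The numeral for one. -/
def tone {n : ℕ} : Tm n :=
  FirstOrder.Language.Term.func ((fun _ => 1 : (Fin 0 → ℕ) → ℕ) : LN.Functions 0) ![]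

/-- The term `t + 1`. -/
def tsucc {n : ℕ} (t : Tm n) : Tm n :=
  FirstOrder.Language.Term.func ((fun v => v 0 + v 1 : (Fin 2 → ℕ) → ℕ) : LN.Functions 2) ![t, tone]

/-- The binary predicate symbol for a relation on `ℕ`. -/
def sym (r : ℕ → ℕ → Prop) : LN.Relations 2 := fun v : Fin 2 → ℕ => r (v 0) (v 1)

/-- A term read in the scope of one more (innermost) quantifier, whose variable is new. -/
def liftTm {n : ℕ} (t : Tm n) : Tm (n + 1) := t.relabel (Sum.map id Fin.castSucc)

/-- Formulae in negation normal form of `LN` with a fresh unary predicate symbol `X`, up to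
renaming of bound variables, in the scope of `n` quantifiers. The Boolean of a literal is
its sign; `mem true t` is `t ∈ X`. -/
inductive Fml : ℕ → Type
  | rel {n l : ℕ} (b : Bool) (R : LN.Relations l) (ts : Fin l → Tm n) : Fml n
  | mem {n : ℕ} (b : Bool) (t : Tm n) : Fml n
  | and {n : ℕ} (φ ψ : Fml n) : Fml n
  | or {n : ℕ} (φ ψ : Fml n) : Fml n
  | all {n : ℕ} (φ : Fml (n + 1)) : Fml n
  | ex {n : ℕ} (φ : Fml (n + 1)) : Fml n

noncomputable instance (n : ℕ) : DecidableEq (Fml n) := Classical.decEq _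

namespace Fml

/-- The complement: the negation normal form of the negation. -/
def neg : {n : ℕ} → Fml n → Fml n
  | _, rel b R ts => rel (!b) R ts
  | _, mem b t => mem (!b) t
  | _, and φ ψ => or φ.neg ψ.neg
  | _, or φ ψ => and φ.neg ψ.neg
  | _, all φ => ex φ.neg
  | _, ex φ => all φ.neg

/-- The free variables. -/
def fv : {n : ℕ} → Fml n → Finset ℕ
  | _, rel _ _ ts => Finset.univ.biUnion fun i => (ts i).varFinsetLeft
  | _, mem _ t => t.varFinsetLeft
  | _, and φ ψ => φ.fv ∪ ψ.fv
  | _, or φ ψ => φ.fv ∪ ψ.fv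
  | _, all φ => φ.fv
  | _, ex φ => φ.fv

/-- Substitution of terms for the variables `Sum.inr i`; capture cannot occur. -/
def subst : {n m : ℕ} → (Fin n → Tm m) → Fml n → Fml m
  | _, _, σ, rel b R ts => rel b R fun i => (ts i).subst (Sum.elim fvar σ)
  | _, _, σ, mem b t => mem b (t.subst (Sum.elim fvar σ))
  | _, _, σ, and φ ψ => and (φ.subst σ) (ψ.subst σ)
  | _, _, σ, or φ ψ => or (φ.subst σ) (ψ.subst σ)
  | _, m, σ, all φ =>
      all (φ.subst (Fin.snoc (α := fun _ => Tm (m + 1)) (fun i => liftTm (σ i))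
        (bvar (Fin.last m))))
  | _, m, σ, ex φ =>
      ex (φ.subst (Fin.snoc (α := fun _ => Tm (m + 1)) (fun i => liftTm (σ i))
        (bvar (Fin.last m))))

/-- For `φ = φ(x)`, where `x` is the one outer bound variable: the formula `φ(u)`. -/
def inst (φ : Fml 1) (u : Tm 0) : Fml 0 := φ.subst fun _ => u

/-- For `φ = φ(x)`, where `x` is the one outer bound variable: the formula `φ(x + 1)`. -/
def shift (φ : Fml 1) : Fml 1 := φ.subst fun _ => tsucc (bvar 0)

/-- The symbol `X` does not occur. -/
def XFree : {n : ℕ} → Fml n → Prop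
  | _, rel _ _ _ => True
  | _, mem _ _ => False
  | _, and φ ψ => φ.XFree ∧ ψ.XFree
  | _, or φ ψ => φ.XFree ∧ ψ.XFree
  | _, all φ => φ.XFree
  | _, ex φ => φ.XFree

/-- Literals: atomic formulae and their negations. -/
inductive IsLiteral : {n : ℕ} → Fml n → Prop
  | rel {n l : ℕ} (b : Bool) (R : LN.Relations l) (ts : Fin l → Tm n) : IsLiteral (rel b R ts)
  | mem {n : ℕ} (b : Bool) (t : Tm n) : IsLiteral (mem b t)

/-- Bounded formulae. The bounded quantifiers `∃ x ≤ t, φ` and `∀ x ≤ t, φ` stand for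
`∃ x, (x ≤ t ∧ φ)` and `∀ x, (¬ x ≤ t ∨ φ)`, where `x` does not occur in `t`. -/
inductive IsDelta0 : {n : ℕ} → Fml n → Prop
  | rel {n l : ℕ} (b : Bool) (R : LN.Relations l) (ts : Fin l → Tm n) : IsDelta0 (rel b R ts)
  | mem {n : ℕ} (b : Bool) (t : Tm n) : IsDelta0 (mem b t)
  | and {n : ℕ} {φ ψ : Fml n} : IsDelta0 φ → IsDelta0 ψ → IsDelta0 (and φ ψ)
  | or {n : ℕ} {φ ψ : Fml n} : IsDelta0 φ → IsDelta0 ψ → IsDelta0 (or φ ψ)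
  | bex {n : ℕ} (t : Tm n) {φ : Fml (n + 1)} : IsDelta0 φ →
      IsDelta0 (ex (and (rel true (sym (· ≤ ·)) ![bvar (Fin.last n), liftTm t]) φ))
  | ball {n : ℕ} (t : Tm n) {φ : Fml (n + 1)} : IsDelta0 φ →
      IsDelta0 (all (or (rel false (sym (· ≤ ·)) ![bvar (Fin.last n), liftTm t]) φ))

/-- `IsStrict true i φ`: `φ` consists of exactly `i` alternating quantifiers, the first of them
existential, in front of a bounded formula that is a maximal bounded subformula of `φ`.
`IsStrict false i φ`: the same with a universal first quantifier. The formulae may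
contain `X`. -/
inductive IsStrict : Bool → ℕ → {n : ℕ} → Fml n → Prop
  | zero (b : Bool) {n : ℕ} {φ : Fml n} : IsDelta0 φ → IsStrict b 0 φ
  | ex {i n : ℕ} {φ : Fml (n + 1)} : IsStrict false i φ → ¬ IsDelta0 (ex φ) →
      IsStrict true (i + 1) (ex φ)
  | all {i n : ℕ} {φ : Fml (n + 1)} : IsStrict true i φ → ¬ IsDelta0 (all φ) →
      IsStrict false (i + 1) (all φ)

/-- The class `pΣ_k(X)`. -/
def IsPSigma (k : ℕ) {n : ℕ} (φ : Fml n) : Prop := IsStrict true k φ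

/-- Satisfaction in an `LN`-structure `M` with an interpretation `X` of the new predicate. -/
def Realize {M : Type} [LN.Structure M] (X : Set M) (v : ℕ → M) :
    {n : ℕ} → (Fin n → M) → Fml n → Prop
  | _, xs, rel true R ts =>
      FirstOrder.Language.Structure.RelMap R fun i => (ts i).realize (Sum.elim v xs)
  | _, xs, rel false R ts =>
      ¬ FirstOrder.Language.Structure.RelMap R fun i => (ts i).realize (Sum.elim v xs)
  | _, xs, mem true t => t.realize (Sum.elim v xs) ∈ X
  | _, xs, mem false t => t.realize (Sum.elim v xs) ∉ X
  | _, xs, and φ ψ => Realize X v xs φ ∧ Realize X v xs ψ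
  | _, xs, or φ ψ => Realize X v xs φ ∨ Realize X v xs ψ
  | n, xs, all φ => ∀ a : M, Realize X v (Fin.snoc (α := fun _ => M) xs a : Fin (n + 1) → M) φ
  | n, xs, ex φ => ∃ a : M, Realize X v (Fin.snoc (α := fun _ => M) xs a : Fin (n + 1) → M) φ

end Fml

open Fml

/-- Sequents: finite sets of formulae. -/
abbrev Sequent : Type := Finset (Fml 0)

/-- The free variables of a sequent. -/
def sfv (Γ : Sequent) : Finset ℕ := Γ.biUnion Fml.fv

/-- The sentences of `LN` (without `X`) in one of the classes `pΣ_i` that are true in the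
standard model. -/
def ThN : Set (Fml 0) :=
  {φ | φ.XFree ∧ φ.fv = ∅ ∧ (∃ i, φ.IsPSigma i) ∧ φ.Realize (∅ : Set ℕ) (fun _ => 0) ![]}

/-- The induction formula `(φ(0) ∧ ∀ x, (φ(x) → φ(x + 1))) → ∀ x, φ(x)`. -/
def indFml (φ : Fml 1) : Fml 0 :=
  .or (Fml.neg (.and (φ.inst tzero) (.all (.or φ.neg φ.shift)))) (.all φ)

/-- The theory `IΣ_k(X)`: the sentences in `ThN`, and induction for all `pΣ_k(X)`-formulae
(with parameters: a formula with free variables stands for its universal closure). -/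
def ISigma (k : ℕ) : Set (Fml 0) := ThN ∪ {ψ | ∃ φ : Fml 1, φ.IsPSigma k ∧ ψ = indFml φ}

/-- The theory `T` proves the sequent `S` in first-order logic with equality: every structure
for the language with `X`, in which the equality symbol is interpreted by equality and all
formulae in `T` are valid, satisfies the universal closure of the disjunction of `S`. -/
def Proves (T : Set (Fml 0)) (S : Sequent) : Prop :=
  ∀ (M : Type) [LN.Structure M] (X : Set M),
    (∀ x : Fin 2 → M, FirstOrder.Language.Structure.RelMap (sym (· = ·)) x ↔ x 0 = x 1) →
    (∀ φ ∈ T, ∀ v : ℕ → M, φ.Realize X v ![]) →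
    ∀ v : ℕ → M, ∃ φ ∈ S, φ.Realize X v ![]

/-- The derivation rules: `Rule k Γ Δs` says that `Γ` is derived from the list `Δs` of premises
by one rule application. -/
inductive Rule (k : ℕ) : Sequent → List Sequent → Prop
  | initial {Γ : Sequent} (L : Fml 0) : L.IsLiteral → L ∈ Γ → L.neg ∈ Γ → Rule k Γ []
  | or_left {Γ : Sequent} (φ ψ : Fml 0) : .or φ ψ ∈ Γ → φ ∉ Γ → Rule k Γ [insert φ Γ]
  | or_right {Γ : Sequent} (φ ψ : Fml 0) : .or φ ψ ∈ Γ → ψ ∉ Γ → Rule k Γ [insert ψ Γ]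
  | ex {Γ : Sequent} (φ : Fml 1) (u : Tm 0) : .ex φ ∈ Γ →
      u.varFinsetLeft ⊆ sfv (insert (φ.inst u) Γ) → sfv (insert (φ.inst u) Γ) = sfv Γ →
      φ.inst u ∉ Γ → Rule k Γ [insert (φ.inst u) Γ]
  | and {Γ : Sequent} (φ ψ : Fml 0) : .and φ ψ ∈ Γ → φ ∉ Γ → ψ ∉ Γ →
      Rule k Γ [insert φ Γ, insert ψ Γ]
  | all {Γ : Sequent} (φ : Fml 1) (a : ℕ) : .all φ ∈ Γ → a ∉ sfv Γ → φ.inst (fvar a) ∉ Γ →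
      sfv (insert (φ.inst (fvar a)) Γ) ⊆ sfv Γ ∪ {a} → Rule k Γ [insert (φ.inst (fvar a)) Γ]
  | true_sentence {Γ : Sequent} (φ : Fml 0) : φ ∈ ThN → φ.neg ∉ Γ → Rule k Γ [insert φ.neg Γ]
  | induction {Γ : Sequent} (φ : Fml 1) (t : Tm 0) (a : ℕ) : φ.IsPSigma k →
      t.varFinsetLeft ⊆ (φ.inst t).fv → φ.inst tzero ∉ Γ →
      ¬ (φ.inst t ∈ Γ ∧ (φ.inst t).neg ∈ Γ) →
      a ∉ sfv Γ → sfv (insert (φ.inst tzero) Γ) = sfv Γ →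
      sfv (insert (φ.inst t).neg Γ) = sfv Γ →
      sfv (insert (φ.inst (fvar a)).neg (insert (φ.inst (tsucc (fvar a))) Γ)) = sfv Γ ∪ {a} →
      Rule k Γ [insert (φ.inst tzero) Γ,
        insert (φ.inst (fvar a)).neg (insert (φ.inst (tsucc (fvar a))) Γ),
        insert (φ.inst t).neg Γ]
  | cut {Γ : Sequent} (φ : Fml 0) : φ.IsPSigma k → φ ∉ Γ → φ.neg ∉ Γ →
      sfv (insert φ Γ) = sfv Γ → sfv (insert φ.neg Γ) = sfv Γ →
      Rule k Γ [insert φ Γ, insert φ.neg Γ]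

/-- An `IΣ_k(X)`-derivation of `S` in free variable normal form without redundancy: a finite
rooted tree of sequences of natural numbers whose vertices are labelled by sequents, the root
by `S`, where the label of each vertex is derived by a rule from the labels of its children,
taken from left to right. Labels outside the tree are irrelevant. -/
structure Derivation (k : ℕ) (S : Sequent) where
  tree : Finset (List ℕ)
  root_mem : [] ∈ tree
  mem_of_prefix : ∀ v w : List ℕ, v <+: w → w ∈ tree → v ∈ tree
  label : List ℕ → Sequent
  label_root : label [] = S
  label_rule : ∀ v ∈ tree, ∃ ks : List ℕ, ks.Pairwise (· < ·) ∧
    (∀ j, j ∈ ks ↔ v ++ [j] ∈ tree) ∧ Rule k (label v) (ks.map fun j => label (v ++ [j]))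

/-- The height of a derivation: the maximal length of a vertex of its tree. -/
def Derivation.height {k : ℕ} {S : Sequent} (π : Derivation k S) : ℕ := π.tree.sup List.length

/-- Transfinite induction along `r`, for the complement of `X`: the sequent of
`∀ y, y ∉ X` and `∃ x₀, ∀ x, (x₀ ∈ X ∧ (x ∉ X ∨ ¬ r x x₀))`. -/
noncomputable def TI (r : ℕ → ℕ → Prop) : Sequent :=
  {.all (.mem false (bvar 0)),
   .ex (.all (.and (.mem true (bvar 0))
     (.or (.mem false (bvar 1)) (.rel false (sym r) ![bvar 1, bvar 0]))))}

end ArithX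

/-!
The proof is a forcing argument. A condition (`Cond`) is partial information about a set `X ⊆ ℕ`:
some elements are known to be in `X`, all other numbers below a bound are known not to be, and the
remaining elements have to be taken from a reservoir. A condition is measured by the ordinals
available to it: `Cond.Big r h c` says that the reservoir contains all elements whose ranks with
respect to `r` lie in some interval of length `ω ^ h` below the known elements of `X`. What makes
everything work is that `ω ^ (h + 1)` contains any finite number of intervals of length `ω ^ h`.

* A `Σ₁(X)`-formula is either made true for good or made false for good by giving up one of two
  intervals (`Cond.Big.cut`). Going through `t + 1` intervals in the same way decides an induction
  up to `t` (`Cond.Big.exists_decidesInduction`): its base fails, or its step fails at some `a`, or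
  its conclusion holds. One may also put a new element into `X` that is smaller than all known ones
  (`Cond.Big.exists_descent`). Each of these costs one factor `ω`.

* For the bound on the height, one climbs a derivation of `TI r` from the root along sequents that
  are refuted by the current condition, apart from the minimum principle, whose instances are refuted
  by a further descent. Each rule costs at most one factor `ω`
  (`Rule.exists_refutesSeq`), and no condition refutes an initial sequent. So a condition of length
  `ω ^ (h + 1)`, which exists as soon as `r` has an element of this rank, excludes the height `h`.

* For the unprovability in first-order logic, a model is constructed. Finitely many tasks (decide a
  bounded part of `X`, decide an induction, descend below an element) can be carried out in finitely
  many stages by a condition of length `ω ^ H` for some finite `H`. An ultrafilter on the finite sets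
  of tasks yields a family of sequences of conditions, almost all of which carry out any given task
  at any given stage (`GenericFamily`). The model consists of the elements of the corresponding
  ultrapower of `ℕ` that are computed from the history up to some standard stage. It has Skolem
  functions for formulae without `X`, as well as for bounded formulae, since bounded parts of `X` are
  decided at the next stage; this gives the truth lemmas `GenericFamily.los_of_XFree` and
  `GenericFamily.los_of_isDelta0`. The tasks of induction and of descent then yield
  the induction axioms for `Σ₁(X)`-formulae, and the failure of `TI r`.
-/

namespace ArithX

open Fml FirstOrder Language Filter

/-! ### Terms and substitution -/

section Realization

variable {M : Type} [LN.Structure M]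

theorem realize_liftTm {n : ℕ} (t : Tm n) (v : ℕ → M) (xs : Fin n → M) (a : M) :
    (liftTm t).realize (Sum.elim v (Fin.snoc (α := fun _ => M) xs a : Fin (n + 1) → M)) =
      t.realize (Sum.elim v xs) := by
  rw [liftTm, Term.realize_relabel]
  congr 1
  funext x
  rcases x with x | x <;> simp [Function.comp]

theorem realize_fvar {n : ℕ} (a : ℕ) (v : ℕ → M) (xs : Fin n → M) :
    (fvar a : Tm n).realize (Sum.elim v xs) = v a := rfl

theorem realize_bvar {n : ℕ} (i : Fin n) (v : ℕ → M) (xs : Fin n → M) :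
    (bvar i : Tm n).realize (Sum.elim v xs) = xs i := rfl

theorem realize_tsucc {n : ℕ} (t : Tm n) (v : ℕ → ℕ) (xs : Fin n → ℕ) :
    (tsucc t).realize (Sum.elim v xs) = t.realize (Sum.elim v xs) + 1 := rfl

theorem realize_subst_elim {n m : ℕ} (t : Tm n) (σ : Fin n → Tm m) (v : ℕ → M)
    (xs : Fin m → M) :
    (t.subst (Sum.elim fvar σ)).realize (Sum.elim v xs) =
      t.realize (Sum.elim v fun i => (σ i).realize (Sum.elim v xs)) := by
  rw [Term.realize_subst]
  congr 1
  funext x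
  rcases x with x | x <;> rfl

theorem liftTm_subst {n m : ℕ} (t : Tm n) (σ : Fin n → Tm m) :
    (liftTm t).subst (Sum.elim fvar (Fin.snoc (α := fun _ => Tm (m + 1))
      (fun i => liftTm (σ i)) (bvar (Fin.last m)))) = liftTm (t.subst (Sum.elim fvar σ)) := by
  induction t with
  | var x =>
    rcases x with x | x
    · rfl
    · simp [liftTm, Term.subst]
  | func f ts ih =>
    simp only [liftTm, Term.relabel, Term.subst] at ih ⊢
    congr 1
    funext i
    exact ih i

theorem mem_varFinsetLeft_subst {n m : ℕ} (t : Tm n) (σ : Fin n → Tm m) {a : ℕ}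
    (ha : a ∈ t.varFinsetLeft) : a ∈ (t.subst (Sum.elim fvar σ)).varFinsetLeft := by
  induction t with
  | var x =>
    rcases x with x | x
    · exact ha
    · simp [Term.varFinsetLeft] at ha
  | func f ts ih =>
    simp only [Term.varFinsetLeft, Term.subst, Finset.mem_biUnion, Finset.mem_univ,
      true_and] at ha ⊢
    obtain ⟨i, hi⟩ := ha
    exact ⟨i, ih i hi⟩

theorem realize_congr_varFinsetLeft {n : ℕ} (t : Tm n) {v w : ℕ → M} (xs : Fin n → M)
    (h : ∀ a ∈ t.varFinsetLeft, v a = w a) :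
    t.realize (Sum.elim v xs) = t.realize (Sum.elim w xs) := by
  induction t with
  | var x =>
    rcases x with x | x
    · exact h x (by simp [Term.varFinsetLeft])
    · rfl
  | func f ts ih =>
    simp only [Term.realize_func]
    congr 1
    funext i
    exact ih i fun a ha => h a (by
      simp only [Term.varFinsetLeft, Finset.mem_biUnion, Finset.mem_univ, true_and]
      exact ⟨i, ha⟩)

/-! ### Formulae -/

namespace Fml

theorem neg_neg : ∀ {n : ℕ} (φ : Fml n), φ.neg.neg = φ
  | _, rel b R ts => by simp [neg]
  | _, mem b t => by simp [neg]
  | _, and φ ψ => by simp [neg, neg_neg φ, neg_neg ψ]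
  | _, or φ ψ => by simp [neg, neg_neg φ, neg_neg ψ]
  | _, all φ => by simp [neg, neg_neg φ]
  | _, ex φ => by simp [neg, neg_neg φ]

theorem realize_neg (X : Set M) (v : ℕ → M) :
    ∀ {n : ℕ} (xs : Fin n → M) (φ : Fml n), φ.neg.Realize X v xs ↔ ¬ φ.Realize X v xs
  | _, xs, rel true R ts => by simp [neg, Realize]
  | _, xs, rel false R ts => by simp [neg, Realize]
  | _, xs, mem true t => by simp [neg, Realize]
  | _, xs, mem false t => by simp [neg, Realize]
  | _, xs, and φ ψ => by
    simp only [neg, Realize, realize_neg X v xs φ, realize_neg X v xs ψ]; tauto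
  | _, xs, or φ ψ => by
    simp only [neg, Realize, realize_neg X v xs φ, realize_neg X v xs ψ]; tauto
  | _, xs, all φ => by
    simp only [neg, Realize, fun a => realize_neg X v (Fin.snoc (α := fun _ => M) xs a) φ,
      not_forall]
  | _, xs, ex φ => by
    simp only [neg, Realize, fun a => realize_neg X v (Fin.snoc (α := fun _ => M) xs a) φ,
      not_exists]

theorem realize_snoc_subst {n m : ℕ} (σ : Fin n → Tm m) (v : ℕ → M) (xs : Fin m → M) (a : M) :
    (fun i => (Fin.snoc (α := fun _ => Tm (m + 1)) (fun i => liftTm (σ i))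
      (bvar (Fin.last m)) i : Tm (m + 1)).realize
        (Sum.elim v (Fin.snoc (α := fun _ => M) xs a : Fin (m + 1) → M))) =
    (Fin.snoc (α := fun _ => M) (fun i => (σ i).realize (Sum.elim v xs)) a : Fin (n + 1) → M) := by
  funext i
  refine Fin.lastCases ?_ (fun i => ?_) i
  · simp [realize_bvar]
  · simp [realize_liftTm]

theorem realize_subst (X : Set M) (v : ℕ → M) :
    ∀ {n m : ℕ} (σ : Fin n → Tm m) (xs : Fin m → M) (φ : Fml n),
      (φ.subst σ).Realize X v xs ↔ φ.Realize X v fun i => (σ i).realize (Sum.elim v xs)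
  | _, _, σ, xs, rel true R ts => by simp only [subst, Realize, realize_subst_elim]
  | _, _, σ, xs, rel false R ts => by simp only [subst, Realize, realize_subst_elim]
  | _, _, σ, xs, mem true t => by simp only [subst, Realize, realize_subst_elim]
  | _, _, σ, xs, mem false t => by simp only [subst, Realize, realize_subst_elim]
  | _, _, σ, xs, and φ ψ => by simp only [subst, Realize, realize_subst X v σ xs]
  | _, _, σ, xs, or φ ψ => by simp only [subst, Realize, realize_subst X v σ xs]
  | _, _, σ, xs, all φ => by
    simp only [subst, Realize]
    refine forall_congr' fun a => ?_
    rw [realize_subst X v _ _ φ, realize_snoc_subst]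
  | _, _, σ, xs, ex φ => by
    simp only [subst, Realize]
    refine exists_congr fun a => ?_
    rw [realize_subst X v _ _ φ, realize_snoc_subst]

theorem realize_inst (X : Set M) (v : ℕ → M) (φ : Fml 1) (u : Tm 0) :
    (φ.inst u).Realize X v ![] ↔ φ.Realize X v fun _ => u.realize (Sum.elim v ![]) :=
  realize_subst X v _ _ φ

theorem snoc_empty {A : Type} (a : A) :
    (Fin.snoc (α := fun _ => A) ![] a : Fin 1 → A) = fun _ => a := by
  funext i
  obtain rfl : i = Fin.last 0 := Subsingleton.elim (α := Fin 1) _ _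
  exact Fin.snoc_last (α := fun _ => A) a ![]

theorem realize_congr_fv (X : Set M) {v w : ℕ → M} :
    ∀ {n : ℕ} (xs : Fin n → M) (φ : Fml n), (∀ a ∈ φ.fv, v a = w a) →
      (φ.Realize X v xs ↔ φ.Realize X w xs)
  | _, xs, rel b R ts, h => by
    have : (fun i => (ts i).realize (Sum.elim v xs)) =
        fun i => (ts i).realize (Sum.elim w xs) := by
      funext i
      exact realize_congr_varFinsetLeft _ _ fun a ha => h a (by
        simp only [fv, Finset.mem_biUnion, Finset.mem_univ, true_and]; exact ⟨i, ha⟩)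
    cases b <;> simp only [Realize, this]
  | _, xs, mem b t, h => by
    have := realize_congr_varFinsetLeft t xs h
    cases b <;> simp only [Realize, this]
  | _, xs, and φ ψ, h => by
    simp only [Realize]
    rw [realize_congr_fv X xs φ fun a ha => h a (Finset.mem_union_left _ ha),
      realize_congr_fv X xs ψ fun a ha => h a (Finset.mem_union_right _ ha)]
  | _, xs, or φ ψ, h => by
    simp only [Realize]
    rw [realize_congr_fv X xs φ fun a ha => h a (Finset.mem_union_left _ ha),
      realize_congr_fv X xs ψ fun a ha => h a (Finset.mem_union_right _ ha)]
  | _, xs, all φ, h => forall_congr' fun a => realize_congr_fv X _ φ h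
  | _, xs, ex φ, h => exists_congr fun a => realize_congr_fv X _ φ h

theorem fv_subset_subst : ∀ {n m : ℕ} (σ : Fin n → Tm m) (φ : Fml n), φ.fv ⊆ (φ.subst σ).fv
  | _, _, σ, rel b R ts => by
    intro a ha
    simp only [fv, subst, Finset.mem_biUnion, Finset.mem_univ, true_and] at ha ⊢
    obtain ⟨i, hi⟩ := ha
    exact ⟨i, mem_varFinsetLeft_subst _ _ hi⟩
  | _, _, σ, mem b t => fun a ha => mem_varFinsetLeft_subst _ _ ha
  | _, _, σ, and φ ψ => Finset.union_subset_union (fv_subset_subst σ φ) (fv_subset_subst σ ψ)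
  | _, _, σ, or φ ψ => Finset.union_subset_union (fv_subset_subst σ φ) (fv_subset_subst σ ψ)
  | _, _, σ, all φ => fv_subset_subst _ φ
  | _, _, σ, ex φ => fv_subset_subst _ φ

theorem XFree.neg : ∀ {n : ℕ} {φ : Fml n}, φ.XFree → φ.neg.XFree
  | _, .rel _ _ _, _ => trivial
  | _, .and _ _, h => ⟨XFree.neg h.1, XFree.neg h.2⟩
  | _, .or _ _, h => ⟨XFree.neg h.1, XFree.neg h.2⟩
  | _, .all φ, h => XFree.neg (φ := φ) h
  | _, .ex φ, h => XFree.neg (φ := φ) h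

theorem XFree.subst : ∀ {n m : ℕ} (σ : Fin n → Tm m) {φ : Fml n}, φ.XFree → (φ.subst σ).XFree
  | _, _, _, .rel _ _ _, _ => trivial
  | _, _, σ, .and _ _, h => ⟨XFree.subst σ h.1, XFree.subst σ h.2⟩
  | _, _, σ, .or _ _, h => ⟨XFree.subst σ h.1, XFree.subst σ h.2⟩
  | _, _, _, .all φ, h => XFree.subst (φ := φ) _ h
  | _, _, _, .ex φ, h => XFree.subst (φ := φ) _ h

theorem XFree.realize_iff (X Y : Set M) (v : ℕ → M) :
    ∀ {n : ℕ} (xs : Fin n → M) {φ : Fml n}, φ.XFree → (φ.Realize X v xs ↔ φ.Realize Y v xs)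
  | _, _, .rel true _ _, _ => Iff.rfl
  | _, _, .rel false _ _, _ => Iff.rfl
  | _, xs, .and _ _, h => and_congr (XFree.realize_iff X Y v xs h.1) (XFree.realize_iff X Y v xs h.2)
  | _, xs, .or _ _, h => or_congr (XFree.realize_iff X Y v xs h.1) (XFree.realize_iff X Y v xs h.2)
  | _, _, .all φ, h => forall_congr' fun _ => XFree.realize_iff (φ := φ) X Y v _ h
  | _, _, .ex φ, h => exists_congr fun _ => XFree.realize_iff (φ := φ) X Y v _ h

theorem IsDelta0.neg {n : ℕ} {φ : Fml n} (h : φ.IsDelta0) : φ.neg.IsDelta0 := by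
  induction h with
  | rel b R ts => exact .rel _ _ _
  | mem b t => exact .mem _ _
  | and _ _ ih₁ ih₂ => exact .or ih₁ ih₂
  | or _ _ ih₁ ih₂ => exact .and ih₁ ih₂
  | bex t _ ih => exact .ball t ih
  | ball t _ ih => exact .bex t ih

theorem IsDelta0.subst {n : ℕ} {φ : Fml n} (h : φ.IsDelta0) :
    ∀ {m : ℕ} (σ : Fin n → Tm m), (φ.subst σ).IsDelta0 := by
  -- the bounding atom `x ≤ t` is turned into `x ≤ t'`, where `t'` is `t` after the substitution
  have key : ∀ {n m : ℕ} (t : Tm n) (σ : Fin n → Tm m),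
      (fun i => ((![bvar (Fin.last n), liftTm t] : Fin 2 → Tm (n + 1)) i).subst (Sum.elim fvar
        (Fin.snoc (α := fun _ => Tm (m + 1)) (fun i => liftTm (σ i)) (bvar (Fin.last m))))) =
      ![bvar (Fin.last m), liftTm (t.subst (Sum.elim fvar σ))] := by
    intro n m t σ
    funext i
    refine Fin.cases ?_ (fun i => ?_) i
    · simp [bvar, Term.subst]
    · rw [Subsingleton.elim i 0]
      exact liftTm_subst t σ
  induction h with
  | rel b R ts => exact fun σ => .rel _ _ _
  | mem b t => exact fun σ => .mem _ _
  | and _ _ ih₁ ih₂ => exact fun σ => .and (ih₁ σ) (ih₂ σ)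
  | or _ _ ih₁ ih₂ => exact fun σ => .or (ih₁ σ) (ih₂ σ)
  | bex t _ ih =>
    intro m σ
    simp only [Fml.subst]
    rw [key t σ]
    exact .bex _ (ih _)
  | ball t _ ih =>
    intro m σ
    simp only [Fml.subst]
    rw [key t σ]
    exact .ball _ (ih _)

end Fml

end Realization

/-! ### Bounded formulae depend on a bounded part of `X` -/

/-- `Y` and `Z` have the same elements below `N`. -/
def AgreeBelow (N : ℕ) (Y Z : Set ℕ) : Prop := ∀ x < N, x ∈ Y ↔ x ∈ Z

theorem AgreeBelow.mono {N N' : ℕ} {Y Z : Set ℕ} (h : AgreeBelow N' Y Z) (hN : N ≤ N') :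
    AgreeBelow N Y Z := fun x hx => h x (hx.trans_le hN)

namespace Fml

theorem realize_and_le (Y : Set ℕ) (v : ℕ → ℕ) {n : ℕ} (xs : Fin n → ℕ) (a : ℕ) (t : Tm n)
    (φ : Fml (n + 1)) :
    (Fml.and (rel true (sym (· ≤ ·)) ![bvar (Fin.last n), liftTm t]) φ).Realize Y v
        (Fin.snoc (α := fun _ => ℕ) xs a) ↔
      a ≤ t.realize (Sum.elim v xs) ∧ φ.Realize Y v (Fin.snoc (α := fun _ => ℕ) xs a) := by
  simp only [Realize]
  refine and_congr ?_ Iff.rfl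
  change (bvar (Fin.last n) : Tm (n + 1)).realize (Sum.elim v (Fin.snoc (α := fun _ => ℕ) xs a)) ≤
    (liftTm t).realize (Sum.elim v (Fin.snoc (α := fun _ => ℕ) xs a)) ↔ _
  rw [realize_liftTm, realize_bvar, Fin.snoc_last]

theorem IsDelta0.exists_agreeBelow {n : ℕ} {φ : Fml n} (h : φ.IsDelta0) (v : ℕ → ℕ) :
    ∀ xs : Fin n → ℕ, ∃ N, ∀ Y Z, AgreeBelow N Y Z → (φ.Realize Y v xs ↔ φ.Realize Z v xs) := by
  have hneg : ∀ {n : ℕ} {φ : Fml n},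
      (∀ xs : Fin n → ℕ, ∃ N, ∀ Y Z, AgreeBelow N Y Z →
        (φ.Realize Y v xs ↔ φ.Realize Z v xs)) →
      ∀ xs : Fin n → ℕ, ∃ N, ∀ Y Z, AgreeBelow N Y Z →
        (φ.neg.Realize Y v xs ↔ φ.neg.Realize Z v xs) := by
    intro n φ h xs
    obtain ⟨N, hN⟩ := h xs
    exact ⟨N, fun Y Z hYZ => by rw [realize_neg, realize_neg, hN Y Z hYZ]⟩
  have hbex : ∀ {n : ℕ} (t : Tm n) {φ : Fml (n + 1)},
      (∀ xs : Fin (n + 1) → ℕ, ∃ N, ∀ Y Z, AgreeBelow N Y Z →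
        (φ.Realize Y v xs ↔ φ.Realize Z v xs)) →
      ∀ xs : Fin n → ℕ, ∃ N, ∀ Y Z, AgreeBelow N Y Z →
        ((Fml.ex (Fml.and (Fml.rel true (sym (· ≤ ·)) ![bvar (Fin.last n), liftTm t])
          φ)).Realize Y v xs ↔
        (Fml.ex (Fml.and (Fml.rel true (sym (· ≤ ·)) ![bvar (Fin.last n), liftTm t])
          φ)).Realize Z v xs) := by
    intro n t φ h xs
    choose N hN using h
    refine ⟨(Finset.range (t.realize (Sum.elim v xs) + 1)).sup
      fun a => N (Fin.snoc (α := fun _ => ℕ) xs a), fun Y Z hYZ => ?_⟩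
    refine exists_congr fun a => ?_
    rw [realize_and_le, realize_and_le]
    refine and_congr_right fun ha => hN _ Y Z (hYZ.mono ?_)
    exact Finset.le_sup (f := fun a => N (Fin.snoc (α := fun _ => ℕ) xs a))
      (Finset.mem_range.2 (Nat.lt_succ_of_le ha))
  induction h with
  | rel b R ts => exact fun xs => ⟨0, fun Y Z _ => by cases b <;> exact Iff.rfl⟩
  | mem b t =>
    intro xs
    refine ⟨t.realize (Sum.elim v xs) + 1, fun Y Z hYZ => ?_⟩
    have := hYZ (t.realize (Sum.elim v xs)) (Nat.lt_succ_self _)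
    cases b
    · exact not_congr this
    · exact this
  | and _ _ ih₁ ih₂ =>
    intro xs
    obtain ⟨N₁, h₁⟩ := ih₁ xs
    obtain ⟨N₂, h₂⟩ := ih₂ xs
    exact ⟨max N₁ N₂, fun Y Z hYZ => and_congr (h₁ Y Z (hYZ.mono (le_max_left _ _)))
      (h₂ Y Z (hYZ.mono (le_max_right _ _)))⟩
  | or _ _ ih₁ ih₂ =>
    intro xs
    obtain ⟨N₁, h₁⟩ := ih₁ xs
    obtain ⟨N₂, h₂⟩ := ih₂ xs
    exact ⟨max N₁ N₂, fun Y Z hYZ => or_congr (h₁ Y Z (hYZ.mono (le_max_left _ _)))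
      (h₂ Y Z (hYZ.mono (le_max_right _ _)))⟩
  | bex t _ ih => exact hbex t ih
  | @ball _ t φ _ ih =>
    have := hneg (hbex t (hneg ih))
    simpa only [Fml.neg, neg_neg, Bool.not_true] using this

theorem IsPSigma.exists_eq_ex {n : ℕ} {φ : Fml n} (h : φ.IsPSigma 1) :
    ∃ ψ : Fml (n + 1), ψ.IsDelta0 ∧ φ = ex ψ := by
  cases h with
  | ex h _ => cases h with | zero _ h => exact ⟨_, h, rfl⟩

end Fml

/-! ### Conditions -/

section

/-- A forcing condition, that is, partial information about a set `X ⊆ ℕ`: the elements of `P` are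
in `X`, and all other elements of `X` are in `A` and at least `n`. The reservoir `A` is recorded as a
set and not by ordinals, so that conditions form a type in the lowest universe, in which the models
have to live. -/
structure Cond where
  P : Set ℕ
  n : ℕ
  A : Set ℕ

namespace Cond

/-- `Y` is a set that `c` admits as the value of `X`. -/
def Ext (c : Cond) (Y : Set ℕ) : Prop := c.P ⊆ Y ∧ ∀ x ∈ Y, x ∉ c.P → c.n ≤ x ∧ x ∈ c.A

/-- Conditions with more information are smaller. -/
instance : LE Cond where
  le c d := d.Ext c.P ∧ d.n ≤ c.n ∧ c.A ⊆ d.A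

theorem ext_self (c : Cond) : c.Ext c.P := ⟨subset_rfl, fun _ hx hx' => absurd hx hx'⟩

theorem Ext.of_le {c d : Cond} {Y : Set ℕ} (h : c.Ext Y) (hcd : c ≤ d) : d.Ext Y := by
  refine ⟨hcd.1.1.trans h.1, fun x hx hxd => ?_⟩
  by_cases hxc : x ∈ c.P
  · exact hcd.1.2 x hxc hxd
  · exact ⟨hcd.2.1.trans (h.2 x hx hxc).1, hcd.2.2 (h.2 x hx hxc).2⟩

instance : Preorder Cond where
  le_refl c := ⟨c.ext_self, le_rfl, subset_rfl⟩
  le_trans _ _ _ h h' := ⟨Ext.of_le h.1 h', h'.2.1.trans h.2.1, h.2.2.trans h'.2.2⟩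

theorem Ext.agreeBelow {c : Cond} {Y : Set ℕ} (h : c.Ext Y) : AgreeBelow c.n Y c.P := by
  refine fun x hx => ⟨fun hY => ?_, fun hP => h.1 hP⟩
  by_contra hP
  exact absurd (h.2 x hY hP).1 (not_le.2 hx)

/-- Decide all atoms below `N`, negatively where they are undecided. -/
def raise (c : Cond) (N : ℕ) : Cond := ⟨c.P, max c.n N, c.A⟩

theorem raise_le (c : Cond) (N : ℕ) : c.raise N ≤ c :=
  ⟨c.ext_self, le_max_left _ _, subset_rfl⟩

variable (r : ℕ → ℕ → Prop) [IsWellOrder ℕ r]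

/-- The elements of the `m` intervals of length `ω ^ h` above rank `β` may still be put into `X`,
and everything that is known to be in `X` lies above them. -/
def BigAt (β : Ordinal.{0}) (h m : ℕ) (c : Cond) : Prop :=
  c.P.Nonempty ∧ (∀ x ∈ c.P, β + Ordinal.omega0 ^ h * m ≤ Ordinal.typein r x) ∧
    ∀ x, β ≤ Ordinal.typein r x → Ordinal.typein r x < β + Ordinal.omega0 ^ h * m → x ∈ c.A

/-- A whole interval of length `ω ^ h` below the known elements of `X` is still available. -/
def Big (h : ℕ) (c : Cond) : Prop := ∃ β, BigAt r β h 1 c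

variable {r}

theorem Big.raise {h : ℕ} {c : Cond} (hc : Big r h c) (N : ℕ) : Big r h (c.raise N) := hc

theorem BigAt.mono {β : Ordinal.{0}} {h m h' m' : ℕ} {c : Cond} (hc : BigAt r β h m c)
    (hm : Ordinal.omega0 ^ h' * m' ≤ Ordinal.omega0 ^ h * (m : Ordinal.{0})) :
    BigAt r β h' m' c :=
  have hle : β + Ordinal.omega0 ^ h' * m' ≤ β + Ordinal.omega0 ^ h * m := by gcongr
  ⟨hc.1, fun x hx => hle.trans (hc.2.1 x hx), fun x h₁ h₂ => hc.2.2 x h₁ (h₂.trans_le hle)⟩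

/-- The step on which all bounds rest: `ω ^ (h + 1) = ω ^ h * ω` contains any finite number of
consecutive intervals of length `ω ^ h`. -/
theorem Big.exists_bigAt {h : ℕ} {c : Cond} (hc : Big r (h + 1) c) :
    ∃ β, ∀ m, BigAt r β h m c := by
  obtain ⟨β, hβ⟩ := hc
  refine ⟨β, fun m => hβ.mono ?_⟩
  rw [pow_succ, Nat.cast_one, mul_one]
  gcongr
  exact (Ordinal.natCast_lt_omega0 m).le

theorem Big.of_succ {h : ℕ} {c : Cond} (hc : Big r (h + 1) c) : Big r h c :=
  let ⟨β, hβ⟩ := hc.exists_bigAt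
  ⟨β, hβ 1⟩

/-- Restricting new elements of `X` to the topmost of `m + 1` intervals gives a condition `d`, and
whatever is then put into `X`, the other `m` intervals remain available below it. -/
theorem BigAt.exists_top {β : Ordinal.{0}} {h m : ℕ} {c : Cond} (hc : BigAt r β h (m + 1) c) :
    ∃ d ≤ c, Big r h d ∧
      ∀ Y, d.Ext Y → ∀ N, ∃ e ≤ c, BigAt r β h m e ∧ e.P = Y ∧ N ≤ e.n := by
  obtain ⟨hP, hP', hA⟩ := hc
  have hm : β + Ordinal.omega0 ^ h * m + Ordinal.omega0 ^ h * (1 : ℕ) =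
      β + Ordinal.omega0 ^ h * (m + 1 : ℕ) := by
    rw [Nat.cast_one, mul_one, Nat.cast_succ, mul_add_one, add_assoc]
  have hle : β + Ordinal.omega0 ^ h * m ≤ β + Ordinal.omega0 ^ h * (m + 1 : ℕ) :=
    hm ▸ le_self_add
  refine ⟨⟨c.P, c.n, {x | x ∈ c.A ∧ β + Ordinal.omega0 ^ h * m ≤ Ordinal.typein r x}⟩,
    ⟨c.ext_self, le_rfl, fun x hx => hx.1⟩,
    ⟨β + Ordinal.omega0 ^ h * m, hP, fun x hx => hm ▸ hP' x hx, fun x h₁ h₂ => ?_⟩,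
    fun Y hY N => ⟨⟨Y, max c.n N, c.A⟩, ⟨⟨hY.1, fun x hx hx' => ?_⟩, le_max_left _ _, subset_rfl⟩,
      ⟨hP.mono hY.1, fun x hx => ?_, fun x h₁ h₂ => hA x h₁ (h₂.trans_le hle)⟩, rfl,
      le_max_right _ _⟩⟩
  · exact ⟨hA x (le_self_add.trans h₁) (hm ▸ h₂), h₁⟩
  · exact ⟨(hY.2 x hx hx').1, (hY.2 x hx hx').2.1⟩
  · by_cases hx' : x ∈ c.P
    · exact hle.trans (hP' x hx')
    · exact (hY.2 x hx hx').2.2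

/-- A property of sets, read as `∃ y, Q y X` with each `Q y` depending on a bounded part of its
argument, is made false for good or true for good by using up one interval. -/
theorem BigAt.cut {β : Ordinal.{0}} {h m : ℕ} {c : Cond} (hc : BigAt r β h (m + 1) c)
    (Q : ℕ → Set ℕ → Prop) (hQ : ∀ y, ∃ N, ∀ Y Z, AgreeBelow N Y Z → (Q y Y ↔ Q y Z)) :
    (∃ d ≤ c, Big r h d ∧ ∀ Y, d.Ext Y → ∀ y, ¬ Q y Y) ∨
      ∃ d ≤ c, BigAt r β h m d ∧ ∃ y, ∀ Y, d.Ext Y → Q y Y := by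
  obtain ⟨d, hdc, hd, htop⟩ := hc.exists_top
  by_cases hY : ∃ Y, d.Ext Y ∧ ∃ y, Q y Y
  · obtain ⟨Y, hY, y, hy⟩ := hY
    obtain ⟨N, hN⟩ := hQ y
    obtain ⟨e, hec, he, rfl, heN⟩ := htop Y hY N
    exact .inr ⟨e, hec, he, y, fun Z hZ => (hN Z e.P (hZ.agreeBelow.mono heN)).2 hy⟩
  · push Not at hY
    exact .inl ⟨d, hdc, hd, hY⟩

theorem Big.cut {h : ℕ} {c : Cond} (hc : Big r (h + 1) c)
    (Q : ℕ → Set ℕ → Prop) (hQ : ∀ y, ∃ N, ∀ Y Z, AgreeBelow N Y Z → (Q y Y ↔ Q y Z)) :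
    ∃ d ≤ c, Big r h d ∧
      ((∀ Y, d.Ext Y → ∀ y, ¬ Q y Y) ∨ ∃ y, ∀ Y, d.Ext Y → Q y Y) := by
  obtain ⟨β, hβ⟩ := hc.exists_bigAt
  obtain ⟨d, hdc, hd, h'⟩ | ⟨d, hdc, hd, h'⟩ := (hβ (1 + 1)).cut Q hQ
  exacts [⟨d, hdc, hd, .inl h'⟩, ⟨d, hdc, ⟨β, hd⟩, .inr h'⟩]

/-- The three ways in which `c` falsifies a premise of the induction rule with conclusion
`∃ y, Q t y X`: the induction base fails for good; the induction step fails for good at some `a`;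
the conclusion holds for good. -/
def DecidesInduction (c : Cond) (Q : ℕ → ℕ → Set ℕ → Prop) (t : ℕ) : Prop :=
  (∀ Y, c.Ext Y → ∀ y, ¬ Q 0 y Y) ∨
    (∃ a, (∃ y, ∀ Y, c.Ext Y → Q a y Y) ∧ ∀ Y, c.Ext Y → ∀ y, ¬ Q (a + 1) y Y) ∨
    ∃ y, ∀ Y, c.Ext Y → Q t y Y

theorem DecidesInduction.of_le {c d : Cond} {Q : ℕ → ℕ → Set ℕ → Prop} {t : ℕ}
    (h : d.DecidesInduction Q t) (hcd : c ≤ d) : c.DecidesInduction Q t := by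
  obtain h | ⟨a, ⟨y, h₁⟩, h₂⟩ | ⟨y, h⟩ := h
  · exact .inl fun Y hY => h Y (hY.of_le hcd)
  · exact .inr (.inl ⟨a, ⟨y, fun Y hY => h₁ Y (hY.of_le hcd)⟩, fun Y hY => h₂ Y (hY.of_le hcd)⟩)
  · exact .inr (.inr ⟨y, fun Y hY => h Y (hY.of_le hcd)⟩)

/-- An induction up to `t` is decided by going down through `t + 1` intervals of length `ω ^ h`,
making `∃ y, Q j y X` true in the `j`-th of them as long as this is possible. -/
theorem Big.exists_decidesInduction {h : ℕ} {c : Cond} (hc : Big r (h + 1) c)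
    (Q : ℕ → ℕ → Set ℕ → Prop)
    (hQ : ∀ x y, ∃ N, ∀ Y Z, AgreeBelow N Y Z → (Q x y Y ↔ Q x y Z)) (t : ℕ) :
    ∃ d ≤ c, Big r h d ∧ d.DecidesInduction Q t := by
  obtain ⟨β, hβ⟩ := hc.exists_bigAt
  have key : ∀ j m, (∃ d ≤ c, Big r h d ∧ d.DecidesInduction Q t) ∨
      ∃ d ≤ c, BigAt r β h m d ∧ ∃ y, ∀ Y, d.Ext Y → Q j y Y := by
    intro j
    induction j with
    | zero =>
      intro m
      obtain ⟨d, hdc, hd, h'⟩ | h' := (hβ (m + 1)).cut (Q 0) (hQ 0)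
      exacts [.inl ⟨d, hdc, hd, .inl h'⟩, .inr h']
    | succ j ih =>
      intro m
      obtain h' | ⟨e, hec, he, y, hy⟩ := ih (m + 1)
      · exact .inl h'
      obtain ⟨d, hde, hd, h'⟩ | ⟨d, hde, hd, h'⟩ := he.cut (Q (j + 1)) (hQ (j + 1))
      · exact .inl ⟨d, le_trans hde hec, hd,
          .inr (.inl ⟨j, ⟨y, fun Y hY => hy Y (hY.of_le hde)⟩, h'⟩)⟩
      · exact .inr ⟨d, le_trans hde hec, hd, h'⟩
  obtain h' | ⟨d, hdc, hd, h'⟩ := key t 1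
  exacts [h', ⟨d, hdc, ⟨β, hd⟩, .inr (.inr h')⟩]

/-- A new element can be put into `X` below all known ones. It is taken from the lowest `ω` ranks
of the upper of two intervals, since only finitely many of these ranks belong to numbers that are
already decided. -/
theorem Big.exists_descent {h : ℕ} {c : Cond} (hc : Big r (h + 2) c) :
    ∃ d ≤ c, Big r (h + 1) d ∧ ∃ x ∈ d.P, ∀ z ∈ c.P, r x z := by
  obtain ⟨β, hβ⟩ := hc.exists_bigAt
  obtain ⟨d, hdc, ⟨γ, hdP, hdγ, hdA⟩, htop⟩ := (hβ (1 + 1)).exists_top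
  have hω : ∀ k : ℕ, γ + k < γ + Ordinal.omega0 ^ (h + 1) * (1 : ℕ) := by
    intro k
    rw [Nat.cast_one, mul_one, pow_succ]
    gcongr
    exact (Ordinal.natCast_lt_omega0 k).trans_le
      (Ordinal.le_mul_right _ (pos_iff_ne_zero.2 (pow_ne_zero _ Ordinal.omega0_ne_zero)))
  have hex : ∀ k : ℕ, ∃ x, Ordinal.typein r x = γ + k := by
    intro k
    obtain ⟨z, hz⟩ := hdP
    exact Ordinal.typein_surj r (((hω k).trans_le (hdγ z hz)).trans (Ordinal.typein_lt_type r z))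
  choose f hf using hex
  have hinj : Function.Injective f := by
    intro k l hkl
    have := (hf k).symm.trans ((congrArg (Ordinal.typein r) hkl).trans (hf l))
    exact_mod_cast add_left_cancel this
  obtain ⟨x, ⟨k, rfl⟩, hk⟩ := (Set.infinite_range_of_injective hinj).exists_gt d.n
  obtain ⟨e, hec, he, heP, -⟩ := htop (insert (f k) d.P) ⟨Set.subset_insert _ _, by
    rintro x (rfl | hx) hx'
    · exact ⟨hk.le, hdA _ (by rw [hf]; exact le_self_add) (by rw [hf]; exact hω k)⟩
    · exact absurd hx hx'⟩ 0
  refine ⟨e, hec, ⟨β, he⟩, f k, heP ▸ Set.mem_insert _ _, fun z hz => ?_⟩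
  rw [← Ordinal.typein_lt_typein r, hf]
  exact (hω k).trans_le (hdγ z (hdc.1.1 hz))

end Cond

end

/-! ### The lower bound on the height of derivations -/

section

namespace Fml

/-- The truth of the formula depends on a bounded part of `X`, for a syntactic reason. -/
def IsBounded {n : ℕ} (φ : Fml n) : Prop := φ.XFree ∨ φ.IsDelta0

/-- The formulae that can be refuted for good by a condition, other than the minimum principle
itself. Apart from the latter, only such formulae occur in the relevant derivations. -/
def IsSimple {n : ℕ} (φ : Fml n) : Prop :=
  φ.IsBounded ∨ ∃ ψ : Fml (n + 1), ψ.IsDelta0 ∧ (φ = ex ψ ∨ φ = all ψ)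

theorem IsBounded.exists_agreeBelow {n : ℕ} {φ : Fml n} (h : φ.IsBounded) (v : ℕ → ℕ)
    (xs : Fin n → ℕ) : ∃ N, ∀ Y Z, AgreeBelow N Y Z → (φ.Realize Y v xs ↔ φ.Realize Z v xs) :=
  h.elim (fun h => ⟨0, fun Y Z _ => h.realize_iff Y Z v xs⟩) fun h => h.exists_agreeBelow v xs

theorem IsSimple.bounded_of_and {n : ℕ} {φ ψ : Fml n} (h : (φ.and ψ).IsSimple) :
    φ.IsBounded ∧ ψ.IsBounded := by
  obtain (h | h) | ⟨_, _, h | h⟩ := h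
  · exact ⟨.inl h.1, .inl h.2⟩
  · cases h with | and h₁ h₂ => exact ⟨.inr h₁, .inr h₂⟩
  · cases h
  · cases h

theorem IsSimple.bounded_of_or {n : ℕ} {φ ψ : Fml n} (h : (φ.or ψ).IsSimple) :
    φ.IsBounded ∧ ψ.IsBounded := by
  obtain (h | h) | ⟨_, _, h | h⟩ := h
  · exact ⟨.inl h.1, .inl h.2⟩
  · cases h with | or h₁ h₂ => exact ⟨.inr h₁, .inr h₂⟩
  · cases h
  · cases h

theorem IsSimple.bounded_of_ex {n : ℕ} {φ : Fml (n + 1)} (h : (ex φ).IsSimple) :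
    φ.IsBounded := by
  obtain (h | h) | ⟨_, h, h' | h'⟩ := h
  · exact .inl h
  · cases h with | bex t h => exact .inr (.and (.rel _ _ _) h)
  · cases h'; exact .inr h
  · cases h'

theorem IsSimple.bounded_of_all {n : ℕ} {φ : Fml (n + 1)} (h : (all φ).IsSimple) :
    φ.IsBounded := by
  obtain (h | h) | ⟨_, h, h' | h'⟩ := h
  · exact .inl h
  · cases h with | ball t h => exact .inr (.or (.rel _ _ _) h)
  · cases h'
  · cases h'; exact .inr h

theorem IsBounded.subst {n m : ℕ} {φ : Fml n} (h : φ.IsBounded) (σ : Fin n → Tm m) :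
    (φ.subst σ).IsBounded := h.imp (·.subst σ) (·.subst σ)

theorem IsSimple.neg {n : ℕ} {φ : Fml n} (h : φ.IsSimple) : φ.neg.IsSimple := by
  obtain h | ⟨ψ, h, rfl | rfl⟩ := h
  · exact .inl (h.imp (·.neg) (·.neg))
  · exact .inr ⟨_, h.neg, .inr rfl⟩
  · exact .inr ⟨_, h.neg, .inl rfl⟩

theorem isSimple_ex {n : ℕ} {ψ : Fml (n + 1)} (h : ψ.IsDelta0) : (ex ψ).IsSimple :=
  .inr ⟨ψ, h, .inl rfl⟩

end Fml

/-- The matrix of the second formula of `TI r`: `x₀` is in `X` and no `x` in `X` is `r`-below. -/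
def isMinFml (r : ℕ → ℕ → Prop) : Fml 1 :=
  .all (.and (.mem true (bvar 0))
    (.or (.mem false (bvar 1)) (.rel false (sym r) ![bvar 1, bvar 0])))

/-- The minimum principle, the second formula of `TI r`. -/
def minFml (r : ℕ → ℕ → Prop) : Fml 0 := .ex (isMinFml r)

theorem realize_isMinFml {M : Type} [LN.Structure M] (r : ℕ → ℕ → Prop) (X : Set M) (v : ℕ → M)
    (a : M) : (isMinFml r).Realize X v (fun _ => a) ↔
      ∀ x, a ∈ X ∧ (x ∉ X ∨ ¬ Structure.RelMap (sym r) ![x, a]) := by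
  have h : ∀ x : M, (fun i => (![bvar 1, bvar 0] i : Tm 2).realize
      (Sum.elim v (Fin.snoc (α := fun _ => M) (fun _ : Fin 1 => a) x))) = ![x, a] := by
    intro x
    funext i
    refine Fin.cases ?_ (fun i => ?_) i
    · exact Fin.snoc_last (α := fun _ => M) x (fun _ : Fin 1 => a)
    · rw [Subsingleton.elim i 0]
      exact Fin.snoc_castSucc (α := fun _ => M) x (fun _ : Fin 1 => a) 0
  simp only [isMinFml, Realize, h]
  refine forall_congr' fun x => and_congr ?_ (or_congr_left (not_congr ?_))
  · exact iff_of_eq (congrArg (· ∈ X)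
      (Fin.snoc_castSucc (α := fun _ => M) x (fun _ : Fin 1 => a) 0))
  · exact iff_of_eq (congrArg (· ∈ X) (Fin.snoc_last (α := fun _ => M) x (fun _ : Fin 1 => a)))

/-- All sets admitted by `c` falsify `φ` under the assignment `v`. -/
def Cond.Refutes (c : Cond) (v : ℕ → ℕ) (φ : Fml 0) : Prop :=
  ∀ Y, c.Ext Y → ¬ φ.Realize Y v ![]

theorem Cond.Refutes.of_le {c d : Cond} {v : ℕ → ℕ} {φ : Fml 0} (h : d.Refutes v φ)
    (hcd : c ≤ d) : c.Refutes v φ := fun Y hY => h Y (hY.of_le hcd)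

/-- All formulae of `Γ`, the minimum principle excepted, are refuted by `c` under `v`. The minimum
principle is exempt because it is true of every subset of `ℕ` that is not empty. -/
def Cond.RefutesSeq (r : ℕ → ℕ → Prop) (c : Cond) (v : ℕ → ℕ) (Γ : Sequent) : Prop :=
  ∀ φ ∈ Γ, φ = minFml r ∨ φ.IsSimple ∧ c.Refutes v φ

variable {r : ℕ → ℕ → Prop}

theorem Cond.RefutesSeq.of_le {c d : Cond} {v : ℕ → ℕ} {Γ : Sequent}
    (h : d.RefutesSeq r v Γ) (hcd : c ≤ d) : c.RefutesSeq r v Γ :=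
  fun φ hφ => (h φ hφ).imp_right fun h => ⟨h.1, h.2.of_le hcd⟩

theorem Cond.RefutesSeq.insert_formula {c : Cond} {v : ℕ → ℕ} {Γ : Sequent} {φ : Fml 0}
    (h : c.RefutesSeq r v Γ) (hs : φ.IsSimple) (hφ : c.Refutes v φ) :
    c.RefutesSeq r v (insert φ Γ) := by
  intro ψ hψ
  obtain rfl | hψ := Finset.mem_insert.1 hψ
  exacts [.inr ⟨hs, hφ⟩, h ψ hψ]

/-- Assignments that agree on the free variables of a sequent are interchangeable. -/
theorem Cond.RefutesSeq.congr {c : Cond} {v w : ℕ → ℕ} {Γ : Sequent}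
    (h : c.RefutesSeq r v Γ) (hvw : ∀ a ∈ sfv Γ, v a = w a) : c.RefutesSeq r w Γ := by
  refine fun φ hφ => (h φ hφ).imp_right fun h' => ⟨h'.1, fun Y hY => ?_⟩
  rw [← realize_congr_fv Y ![] φ fun a ha => hvw a (Finset.mem_biUnion.2 ⟨φ, hφ, ha⟩)]
  exact h'.2 Y hY

/-- A bounded formula that is false at present becomes refuted as soon as enough atoms are
decided. -/
theorem Fml.IsBounded.exists_refutes {φ : Fml 0} (h : φ.IsBounded) (c : Cond) (v : ℕ → ℕ)
    (hφ : ¬ φ.Realize c.P v ![]) : ∃ N, (c.raise N).Refutes v φ := by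
  obtain ⟨N, hN⟩ := h.exists_agreeBelow v ![]
  exact ⟨N, fun Y hY => by
    rwa [hN Y c.P (hY.agreeBelow.mono (le_max_right c.n N))]⟩

theorem refutes_neg_of_mem_ThN {φ : Fml 0} (h : φ ∈ ThN) (c : Cond) (v : ℕ → ℕ) :
    φ.neg.IsSimple ∧ c.Refutes v φ.neg := by
  obtain ⟨hX, hfv, -, htrue⟩ := h
  refine ⟨.inl (.inl hX.neg), fun Y _ => ?_⟩
  rw [realize_neg, not_not, hX.realize_iff Y ∅, realize_congr_fv (w := fun _ => 0)]
  · exact htrue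
  · simp [hfv]

theorem Fml.IsDelta0.realize_local {ψ : Fml 2} (h : ψ.IsDelta0) (v : ℕ → ℕ) (x y : ℕ) :
    ∃ N, ∀ Y Z, AgreeBelow N Y Z →
      (ψ.Realize Y v (Fin.snoc (α := fun _ => ℕ) (fun _ => x) y) ↔
        ψ.Realize Z v (Fin.snoc (α := fun _ => ℕ) (fun _ => x) y)) :=
  h.exists_agreeBelow v _

theorem sfv_insert (φ : Fml 0) (Γ : Sequent) : sfv (insert φ Γ) = φ.fv ∪ sfv Γ := by
  simp [sfv]

/-- The induction rule: a condition that decides the induction refutes one of the premises. -/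
theorem Cond.RefutesSeq.induction [IsWellOrder ℕ r] {c : Cond} {h : ℕ} {v : ℕ → ℕ} {Γ : Sequent}
    (hΓ : c.RefutesSeq r v Γ) (hc : c.Big r (h + 1)) {φ : Fml 1} (t : Tm 0) {a : ℕ}
    (hφ : φ.IsPSigma 1) (ha : a ∉ sfv Γ) (haφ : a ∉ φ.fv) :
    ∃ (d : Cond) (w : ℕ → ℕ), d.Big r h ∧ (d.RefutesSeq r w (insert (φ.inst tzero) Γ) ∨
      d.RefutesSeq r w (insert (φ.inst (fvar a)).neg (insert (φ.inst (tsucc (fvar a))) Γ)) ∨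
      d.RefutesSeq r w (insert (φ.inst t).neg Γ)) := by
  obtain ⟨ψ, hψ, rfl⟩ := IsPSigma.exists_eq_ex hφ
  have hs : ∀ u, ((Fml.ex ψ).inst u).IsSimple := fun u => isSimple_ex (hψ.subst _)
  obtain ⟨d, hdc, hd, hdec⟩ := hc.exists_decidesInduction
    (fun x y Y => ψ.Realize Y v (Fin.snoc (α := fun _ => ℕ) (fun _ => x) y))
    (hψ.realize_local v) (t.realize (Sum.elim v ![]))
  have hΓd := hΓ.of_le hdc
  obtain h₀ | ⟨m, ⟨y, hy⟩, hm⟩ | ⟨y, hy⟩ := hdec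
  · refine ⟨d, v, hd, .inl (hΓd.insert_formula (hs _) fun Y hY => ?_)⟩
    rw [realize_inst]
    rintro ⟨y, hy⟩
    exact h₀ Y hY y hy
  · have hva : ∀ b, b ≠ a → v b = Function.update v a m b := fun b hb => by simp [hb]
    have hψa : ∀ Y (xs : Fin 2 → ℕ), ψ.Realize Y (Function.update v a m) xs ↔ ψ.Realize Y v xs :=
      fun Y xs => (realize_congr_fv Y xs ψ fun b hb => hva b (by rintro rfl; exact haφ hb)).symm
    refine ⟨d, Function.update v a m, hd, .inr (.inl
      (((hΓd.congr fun b hbΓ => hva b (by rintro rfl; exact ha hbΓ)).insert_formula (hs _)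
        fun Y hY => ?_).insert_formula (hs _).neg fun Y hY => ?_))⟩
    · rw [realize_inst, realize_tsucc, realize_fvar, Function.update_self]
      rintro ⟨y, hy⟩
      exact hm Y hY y ((hψa _ _).1 hy)
    · rw [realize_neg, not_not, realize_inst, realize_fvar, Function.update_self]
      exact ⟨y, (hψa _ _).2 (hy Y hY)⟩
  · refine ⟨d, v, hd, .inr (.inr (hΓd.insert_formula (hs _).neg fun Y hY => ?_))⟩
    rw [realize_neg, not_not, realize_inst]
    exact ⟨y, hy Y hY⟩

theorem Cond.RefutesSeq.cut [IsWellOrder ℕ r] {c : Cond} {h : ℕ} {v : ℕ → ℕ} {Γ : Sequent}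
    (hΓ : c.RefutesSeq r v Γ) (hc : c.Big r (h + 1)) {φ : Fml 0} (hφ : φ.IsPSigma 1) :
    ∃ d : Cond, d.Big r h ∧
      (d.RefutesSeq r v (insert φ Γ) ∨ d.RefutesSeq r v (insert φ.neg Γ)) := by
  obtain ⟨ψ, hψ, rfl⟩ := IsPSigma.exists_eq_ex hφ
  obtain ⟨d, hdc, hd, h' | ⟨y, hy⟩⟩ := hc.cut
    (fun y Y => ψ.Realize Y v (Fin.snoc (α := fun _ => ℕ) ![] y))
    (fun y => hψ.exists_agreeBelow v _)
  · exact ⟨d, hd, .inl ((hΓ.of_le hdc).insert_formula (isSimple_ex hψ) fun Y hY ⟨y, hy⟩ => h' Y hY y hy)⟩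
  · refine ⟨d, hd, .inr ((hΓ.of_le hdc).insert_formula (isSimple_ex hψ).neg fun Y hY => ?_)⟩
    rw [realize_neg, not_not]
    exact ⟨y, hy Y hY⟩

/-- The existential rule applied to the minimum principle: the candidate minimum is out of `X`, or
a smaller element is put into `X`. -/
theorem Cond.RefutesSeq.minFml [IsWellOrder ℕ r] {c : Cond} {h : ℕ} {v : ℕ → ℕ} {Γ : Sequent}
    (hΓ : c.RefutesSeq r v Γ) (hc : c.Big r (h + 2)) (u : Tm 0) :
    ∃ d : Cond, d.Big r (h + 1) ∧ d.RefutesSeq r v (insert ((isMinFml r).inst u) Γ) := by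
  set m := u.realize (Sum.elim v ![]) with hm
  have hs : ((isMinFml r).inst u).IsSimple :=
    .inr ⟨_, .subst (.and (.mem _ _) (.or (.mem _ _) (.rel _ _ _))) _, .inr rfl⟩
  obtain ⟨d, hdc, hd, x, hxd, hx⟩ := (hc.raise (m + 1)).exists_descent
  refine ⟨d, hd, (hΓ.of_le (hdc.trans (c.raise_le _))).insert_formula hs fun Y hY => ?_⟩
  rw [realize_inst, realize_isMinFml, ← hm]
  intro hmin
  have hmY := (hmin 0).1
  have hmc : m ∈ c.P := ((hY.of_le hdc).agreeBelow m
    (lt_of_lt_of_le (Nat.lt_succ_self m) (le_max_right _ _))).1 hmY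
  obtain h | h := (hmin x).2
  exacts [h (hY.1 hxd), h (hx m hmc)]

/-- Every rule with premises that is applied to a refuted sequent has a refuted premise, at the
cost of one factor `ω`. -/
theorem Rule.exists_refutesSeq [IsWellOrder ℕ r] {Γ : Sequent} {Δs : List Sequent}
    (hR : Rule 1 Γ Δs) (hne : Δs ≠ []) {c : Cond} {h : ℕ} {v : ℕ → ℕ}
    (hΓ : c.RefutesSeq r v Γ) (hc : c.Big r (h + 2)) :
    ∃ Δ ∈ Δs, ∃ (d : Cond) (w : ℕ → ℕ), d.Big r (h + 1) ∧ d.RefutesSeq r w Δ := by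
  cases hR with
  | initial => exact absurd rfl hne
  | or_left φ ψ hφψ =>
    obtain h' | ⟨hs, h'⟩ := hΓ _ hφψ
    · cases h'
    exact ⟨_, .head _, c, v, hc.of_succ, hΓ.insert_formula (.inl hs.bounded_of_or.1)
      fun Y hY hφ => h' Y hY (.inl hφ)⟩
  | or_right φ ψ hφψ =>
    obtain h' | ⟨hs, h'⟩ := hΓ _ hφψ
    · cases h'
    exact ⟨_, .head _, c, v, hc.of_succ, hΓ.insert_formula (.inl hs.bounded_of_or.2)
      fun Y hY hφ => h' Y hY (.inr hφ)⟩
  | ex φ u hφ =>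
    obtain h' | ⟨hs, h'⟩ := hΓ _ hφ
    · cases h'
      obtain ⟨d, hd, hdΓ⟩ := hΓ.minFml hc u
      exact ⟨_, .head _, d, v, hd, hdΓ⟩
    · refine ⟨_, .head _, c, v, hc.of_succ, hΓ.insert_formula (.inl (hs.bounded_of_ex.subst _))
        fun Y hY hφu => h' Y hY ⟨u.realize (Sum.elim v ![]), ?_⟩⟩
      rwa [snoc_empty, ← realize_inst]
  | and φ ψ hφψ =>
    obtain h' | ⟨hs, h'⟩ := hΓ _ hφψ
    · cases h'
    by_cases hφ : φ.Realize c.P v ![]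
    · obtain ⟨N, hN⟩ := hs.bounded_of_and.2.exists_refutes c v fun hψ => h' _ c.ext_self ⟨hφ, hψ⟩
      exact ⟨_, .tail _ (.head _), _, v, (hc.raise N).of_succ,
        (hΓ.of_le (c.raise_le N)).insert_formula (.inl hs.bounded_of_and.2) hN⟩
    · obtain ⟨N, hN⟩ := hs.bounded_of_and.1.exists_refutes c v hφ
      exact ⟨_, .head _, _, v, (hc.raise N).of_succ,
        (hΓ.of_le (c.raise_le N)).insert_formula (.inl hs.bounded_of_and.1) hN⟩
  | all φ a hφ ha =>
    obtain h' | ⟨hs, h'⟩ := hΓ _ hφ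
    · cases h'
    obtain ⟨m, hm⟩ := not_forall.1 (h' _ c.ext_self)
    have hva : ∀ b, b ≠ a → v b = Function.update v a m b := fun b hb => by simp [hb]
    have hb : (φ.inst (fvar a)).IsBounded := hs.bounded_of_all.subst _
    obtain ⟨N, hN⟩ := hb.exists_refutes c (Function.update v a m) (by
      rw [realize_inst, realize_fvar, Function.update_self, ← realize_congr_fv, ← snoc_empty]
      · exact hm
      · exact fun b hbφ => hva b (by
          rintro rfl; exact ha (Finset.mem_biUnion.2 ⟨_, hφ, hbφ⟩)))
    exact ⟨_, .head _, _, Function.update v a m, (hc.raise N).of_succ,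
      ((hΓ.of_le (c.raise_le N)).congr fun b hbΓ => hva b (by rintro rfl; exact ha hbΓ)).insert_formula
        (.inl hb) hN⟩
  | true_sentence φ hφ =>
    obtain ⟨hs, h'⟩ := refutes_neg_of_mem_ThN hφ c v
    exact ⟨_, .head _, c, v, hc.of_succ, hΓ.insert_formula hs h'⟩
  | induction φ t a hφ _ _ _ ha hfv =>
    have haφ : a ∉ φ.fv := fun h' => ha (by
      rw [← hfv, sfv_insert]
      exact Finset.mem_union_left _ (fv_subset_subst _ _ h'))
    obtain ⟨d, w, hd, h' | h' | h'⟩ := hΓ.induction hc t hφ ha haφ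
    exacts [⟨_, .head _, d, w, hd, h'⟩, ⟨_, .tail _ (.head _), d, w, hd, h'⟩,
      ⟨_, .tail _ (.tail _ (.head _)), d, w, hd, h'⟩]
  | cut φ hφ =>
    obtain ⟨d, hd, h' | h'⟩ := hΓ.cut hc hφ
    exacts [⟨_, .head _, d, v, hd, h'⟩, ⟨_, .tail _ (.head _), d, v, hd, h'⟩]

/-- No condition refutes an initial sequent. -/
theorem Rule.not_refutesSeq {k : ℕ} {Γ : Sequent} (hR : Rule k Γ []) (c : Cond) (v : ℕ → ℕ) :
    ¬ c.RefutesSeq r v Γ := by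
  intro hΓ
  cases hR with
  | initial L hL hLΓ hLΓ' =>
    obtain h | ⟨-, h⟩ := hΓ L hLΓ
    · subst h; cases hL
    obtain h' | ⟨-, h'⟩ := hΓ _ hLΓ'
    · cases hL <;> cases h'
    exact h' _ c.ext_self ((realize_neg _ _ _ _).2 (h _ c.ext_self))

/-- If at most `j` levels of the derivation lie above the vertex `w`, then no condition with an
interval of length `ω ^ (j + 1)` refutes the label of `w`. -/
theorem Derivation.not_refutesSeq [IsWellOrder ℕ r] {S : Sequent} (π : Derivation 1 S) :
    ∀ (j : ℕ) (w : List ℕ), w ∈ π.tree → π.height ≤ w.length + j →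
      ∀ (c : Cond) (v : ℕ → ℕ), c.Big r (j + 1) → ¬ c.RefutesSeq r v (π.label w) := by
  intro j
  induction j with
  | zero =>
    intro w hw hle c v _ hΓ
    obtain ⟨ks, -, hks, hR⟩ := π.label_rule w hw
    have : ks = [] := List.eq_nil_iff_forall_not_mem.2 fun i hi => by
      have := Finset.le_sup (f := List.length) ((hks i).1 hi)
      rw [List.length_append, List.length_singleton] at this
      exact absurd (this.trans hle) (by simp)
    subst this
    exact hR.not_refutesSeq c v hΓ
  | succ j ih =>
    intro w hw hle c v hc hΓ
    obtain ⟨ks, -, hks, hR⟩ := π.label_rule w hw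
    by_cases hne : ks.map (fun i => π.label (w ++ [i])) = []
    · exact (hne ▸ hR).not_refutesSeq c v hΓ
    · obtain ⟨Δ, hΔ, d, v', hd, hdΔ⟩ := hR.exists_refutesSeq hne hΓ hc
      obtain ⟨i, hi, rfl⟩ := List.mem_map.1 hΔ
      refine ih _ ((hks i).1 hi) ?_ d v' hd hdΔ
      rw [List.length_append, List.length_singleton]
      omega

/-- The condition that puts exactly one element into `X` so far, and allows further elements that are
`r`-smaller and that exceed it as numbers. -/
def Cond.single (r : ℕ → ℕ → Prop) (x : ℕ) : Cond := ⟨{x}, x + 1, {z | r z x}⟩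

theorem Cond.big_single [IsWellOrder ℕ r] {h x : ℕ}
    (hx : Ordinal.typein r x = Ordinal.omega0 ^ h) : (Cond.single r x).Big r h := by
  refine ⟨0, Set.singleton_nonempty x, ?_, ?_⟩
  · rintro _ rfl
    simp [hx]
  · intro z _ hz
    rw [zero_add, Nat.cast_one, mul_one, ← hx, Ordinal.typein_lt_typein] at hz
    exact hz

theorem Cond.exists_single_big [IsWellOrder ℕ r] {h : ℕ}
    (hr : Ordinal.omega0 ^ h < Ordinal.type r) : ∃ x, (Cond.single r x).Big r h :=
  let ⟨x, hx⟩ := Ordinal.typein_surj r hr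
  ⟨x, Cond.big_single hx⟩

theorem Cond.refutesSeq_TI (x : ℕ) (v : ℕ → ℕ) : (Cond.single r x).RefutesSeq r v (TI r) := by
  intro φ hφ
  obtain rfl | hφ := Finset.mem_insert.1 hφ
  · exact .inr ⟨.inr ⟨_, .mem _ _, .inr rfl⟩, fun Y hY h => h x (hY.1 rfl)⟩
  · exact .inl (Finset.mem_singleton.1 hφ)

theorem Derivation.lt_height [IsWellOrder ℕ r] (π : Derivation 1 (TI r)) {h : ℕ}
    (hr : Ordinal.omega0 ^ (h + 1) < Ordinal.type r) : h < π.height := by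
  by_contra hle
  obtain ⟨x, hx⟩ := Cond.exists_single_big hr
  refine π.not_refutesSeq h [] π.root_mem (by simpa using hle) _ (fun _ => 0) hx ?_
  rw [π.label_root]
  exact Cond.refutesSeq_TI x _

end

/-! ### Generic sequences of conditions -/

section

/-- An open set of conditions, depending on a history, that can be entered at the cost of one
factor `ω`. -/
structure Task (r : ℕ → ℕ → Prop) [IsWellOrder ℕ r] where
  D : (ℕ → Cond) → Cond → Prop
  of_le : ∀ σ c d, d ≤ c → D σ c → D σ d
  dense : ∀ σ h c, Cond.Big r (h + 2) c → ∃ d ≤ c, Cond.Big r (h + 1) d ∧ D σ d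

/-- The sequence up to and including stage `k`, continued constantly. -/
def trunc {α : Type} (k : ℕ) (s : ℕ → α) : ℕ → α := fun j => s (min j k)

theorem trunc_trunc {α : Type} {k l : ℕ} (h : k ≤ l) (s : ℕ → α) :
    trunc k (trunc l s) = trunc k s := by
  funext j
  exact congrArg s (by omega)

theorem trunc_self {α : Type} (k : ℕ) (s : ℕ → α) : trunc k s k = s k := by simp [trunc]

variable {r : ℕ → ℕ → Prop} [IsWellOrder ℕ r]

theorem Task.exists_forall_mem (F : Finset (Task r)) (σ : ℕ → Cond) (h : ℕ) :
    ∀ c, Cond.Big r (h + F.card + 1) c →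
      ∃ d ≤ c, Cond.Big r (h + 1) d ∧ ∀ T ∈ F, T.D σ d := by
  classical
  induction F using Finset.induction_on with
  | empty => exact fun c hc => ⟨c, le_rfl, hc, by simp⟩
  | insert T F hT ih =>
    intro c hc
    rw [Finset.card_insert_of_notMem hT] at hc
    obtain ⟨d, hdc, hd, hT⟩ := T.dense σ (h + F.card) c hc
    obtain ⟨e, hed, he, hF⟩ := ih d hd
    refine ⟨e, hed.trans hdc, he, fun T' hT' => ?_⟩
    obtain rfl | hT' := Finset.mem_insert.1 hT'
    exacts [T'.of_le σ d e hed hT, hF T' hT']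

theorem Task.exists_seq (F : Finset (Task r)) (c : Cond) (K : ℕ) :
    ∀ h, Cond.Big r (h + K * F.card + 1) c → ∃ s : ℕ → Cond, s 0 = c ∧ Antitone s ∧
      (∀ k, K ≤ k → s k = s K) ∧ Cond.Big r (h + 1) (s K) ∧
      ∀ k < K, ∀ T ∈ F, T.D (trunc k s) (s (k + 1)) := by
  induction K with
  | zero =>
    intro h hc
    exact ⟨fun _ => c, rfl, fun _ _ _ => le_rfl, fun _ _ => rfl, by simpa using hc, by simp⟩
  | succ K ih =>
    intro h hc
    obtain ⟨s, hs0, hanti, hconst, hbig, hD⟩ := ih (h + F.card) (by convert hc using 1; ring)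
    obtain ⟨d, hd, hdbig, hdF⟩ := Task.exists_forall_mem F (trunc K s) h _ hbig
    have hle : ∀ k, k ≤ K → (if k ≤ K then s k else d) = s k := fun k hk => if_pos hk
    have htr : ∀ k, k ≤ K → trunc k (fun k => if k ≤ K then s k else d) = trunc k s := by
      intro k hk
      funext j
      exact hle _ ((min_le_right _ _).trans hk)
    refine ⟨fun k => if k ≤ K then s k else d, by simpa using hs0, fun k l hkl => ?_,
      fun k hk => ?_, by simpa using hdbig, fun k hk T hT => ?_⟩
    · dsimp only
      split_ifs with h₁ h₂ h₂
      · exact hanti hkl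
      · exact absurd (hkl.trans h₁) h₂
      · exact hd.trans (hanti h₂)
      · exact le_rfl
    · simp [show ¬ k ≤ K by omega]
    · rw [htr k (by omega)]
      obtain hk | rfl := Nat.lt_succ_iff_lt_or_eq.1 hk
      · simpa [Nat.succ_le_of_lt hk] using hD k hk T hT
      · simpa using hdF T hT

variable (r) in
/-- A family of sequences of conditions, indexed by a set with an ultrafilter, such that each task
is carried out at each stage by almost all of the sequences. `X i` is the set produced by the
`i`-th sequence. -/
structure GenericFamily where
  I : Type
  U : Ultrafilter I
  s : I → ℕ → Cond
  X : I → Set ℕ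
  ext_X : ∀ i k, (s i k).Ext (X i)
  nonempty : ∀ i, (s i 0).P.Nonempty
  generic : ∀ (T : Task r) (k : ℕ), ∀ᶠ i in U, T.D (trunc k (s i)) (s i (k + 1))

/-- The `i`-th sequence takes care of a finite set of tasks in a finite number of stages only, so
that it needs no more than an interval of length `ω ^ H` for some finite `H`. -/
theorem GenericFamily.nonempty_of_forall_lt
    (hr : ∀ H : ℕ, Ordinal.omega0 ^ H < Ordinal.type r) : Nonempty (GenericFamily r) := by
  classical
  have key : ∀ i : Finset (Task r) × ℕ, ∃ s : ℕ → Cond, (s 0).P.Nonempty ∧ Antitone s ∧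
      (∀ k, i.2 ≤ k → s k = s i.2) ∧
      ∀ k < i.2, ∀ T ∈ i.1, T.D (trunc k s) (s (k + 1)) := by
    intro i
    obtain ⟨x, hx⟩ := Cond.exists_single_big (hr (0 + i.2 * i.1.card + 1))
    obtain ⟨s, hs, hanti, hconst, -, hD⟩ := Task.exists_seq i.1 _ i.2 0 hx
    exact ⟨s, hs ▸ Set.singleton_nonempty x, hanti, hconst, hD⟩
  choose s hs hanti hconst hD using key
  refine ⟨⟨Finset (Task r) × ℕ, Ultrafilter.of atTop, s, fun i => (s i i.2).P, fun i k => ?_, hs,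
    fun T k => Ultrafilter.of_le _ ?_⟩⟩
  · obtain hk | hk := le_total k i.2
    · exact (hanti i hk).1
    · rw [hconst i k hk]
      exact Cond.ext_self _
  · filter_upwards [eventually_ge_atTop (({T}, k + 1) : Finset (Task r) × ℕ)] with i hi
    exact hD i k hi.2 T (hi.1 (Finset.mem_singleton_self T))

/-- The task of deciding all atoms below a bound computed from the history. -/
def Task.decide (f : (ℕ → Cond) → ℕ) : Task r where
  D σ c := f σ ≤ c.n
  of_le _ _ _ h hc := hc.trans h.2.1
  dense σ _ c hc := ⟨c.raise (f σ), c.raise_le _, (hc.raise _).of_succ, le_max_right _ _⟩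

/-- The task of providing against a number computed from the history being the least element. -/
def Task.descend (f : (ℕ → Cond) → ℕ) : Task r where
  D σ c := (f σ ∉ c.P ∧ f σ < c.n) ∨ ∃ x ∈ c.P, r x (f σ)
  of_le σ c d h hc := by
    obtain ⟨h₁, h₂⟩ | ⟨x, hx, hxr⟩ := hc
    · exact .inl ⟨fun hd => h₁ ((h.1.agreeBelow _ h₂).1 hd), h₂.trans_le h.2.1⟩
    · exact .inr ⟨x, h.1.1 hx, hxr⟩
  dense σ h c hc := by
    by_cases hf : f σ ∈ c.P
    · obtain ⟨d, hdc, hd, x, hx, hxr⟩ := hc.exists_descent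
      exact ⟨d, hdc, hd, .inr ⟨x, hx, hxr _ hf⟩⟩
    · exact ⟨c.raise (f σ + 1), c.raise_le _, (hc.raise _).of_succ,
        .inl ⟨hf, lt_of_lt_of_le (Nat.lt_succ_self _) (le_max_right _ _)⟩⟩

/-- The task of deciding an induction with a parameter computed from the history. -/
def Task.induction (Q : (ℕ → Cond) → ℕ → ℕ → Set ℕ → Prop)
    (hQ : ∀ σ x y, ∃ N, ∀ Y Z, AgreeBelow N Y Z → (Q σ x y Y ↔ Q σ x y Z))
    (t : (ℕ → Cond) → ℕ) : Task r where
  D σ c := c.DecidesInduction (Q σ) (t σ)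
  of_le _ _ _ h hc := hc.of_le h
  dense σ _ _ hc := hc.exists_decidesInduction (Q σ) (hQ σ) (t σ)

end

/-! ### The model of names -/

section

namespace GenericFamily

variable {r : ℕ → ℕ → Prop} [IsWellOrder ℕ r] (G : GenericFamily r)

/-- The history of the `i`-th sequence up to stage `k`. -/
def hist (k : ℕ) (i : G.I) : ℕ → Cond := trunc k (G.s i)

/-- Families of numbers that are computed from the history up to some fixed stage. Those modulo the
ultrafilter form an elementary extension of `ℕ`, contained in the ultrapower. The set `X` is
internal to the ultrapower, but not to this model. -/
def Name : Type := {F : G.I → ℕ // ∃ (k : ℕ) (f : (ℕ → Cond) → ℕ), ∀ i, F i = f (G.hist k i)}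

variable {G}

/-- The image of a name under a function on `ℕ`. -/
def Name.map (g : ℕ → ℕ) (F : G.Name) : G.Name :=
  ⟨fun i => g (F.1 i), F.2.imp fun _ ⟨f, hf⟩ => ⟨fun σ => g (f σ), fun i => congrArg g (hf i)⟩⟩

theorem hist_hist {k l : ℕ} (h : k ≤ l) (i : G.I) : trunc k (G.hist l i) = G.hist k i :=
  trunc_trunc h _

/-- Finitely many names are computed from the history up to a common stage. -/
theorem exists_stage {ι : Type} (S : Finset ι) (F : ι → G.Name) :
    ∃ (k : ℕ) (f : ι → (ℕ → Cond) → ℕ), ∀ a ∈ S, ∀ i, (F a).1 i = f a (G.hist k i) := by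
  choose k f hf using fun a => (F a).2
  refine ⟨S.sup k, fun a σ => f a (trunc (k a) σ), fun a ha i => ?_⟩
  change _ = f a (trunc (k a) _)
  rw [hf, hist_hist (Finset.le_sup ha)]

/-- Choices that depend on the history are made by names. -/
theorem exists_name (k : ℕ) (R : (ℕ → Cond) → ℕ → Prop)
    (h : ∀ᶠ i in G.U, ∃ m, R (G.hist k i) m) :
    ∃ F : G.Name, ∀ᶠ i in G.U, R (G.hist k i) (F.1 i) :=
  ⟨⟨fun i => Classical.epsilon (R (G.hist k i)), k, fun σ => Classical.epsilon (R σ),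
    fun _ => rfl⟩, h.mono fun _ hi => Classical.epsilon_spec hi⟩

/-- Choices that also depend on a part of `X`, bounded in terms of the history, are made by names,
since that part of `X` is decided at the next stage. -/
theorem exists_name_local (k : ℕ) (R : (ℕ → Cond) → ℕ → Set ℕ → Prop)
    (hR : ∀ σ, ∃ N, ∀ m Y Z, AgreeBelow N Y Z → (R σ m Y ↔ R σ m Z))
    (h : ∀ᶠ i in G.U, ∃ m, R (G.hist k i) m (G.X i)) :
    ∃ F : G.Name, ∀ᶠ i in G.U, R (G.hist k i) (F.1 i) (G.X i) := by
  choose N hN using hR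
  have hX : ∀ᶠ i in G.U, ∀ m, R (G.hist k i) m (G.X i) ↔
      R (G.hist k i) m (G.s i (k + 1)).P :=
    (G.generic (Task.decide N) k).mono fun i hi m =>
      hN _ m _ _ ((G.ext_X i (k + 1)).agreeBelow.mono hi)
  have hs : ∀ i, G.hist (k + 1) i (k + 1) = G.s i (k + 1) := fun i => trunc_self _ _
  obtain ⟨F, hF⟩ := exists_name (G := G) (k + 1)
    (fun σ m => R (trunc k σ) m (σ (k + 1)).P) (by
      filter_upwards [h, hX] with i ⟨m, hm⟩ hi
      exact ⟨m, by rw [hist_hist k.le_succ, hs]; exact (hi m).1 hm⟩)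
  refine ⟨F, ?_⟩
  filter_upwards [hF, hX] with i h₁ h₂
  rw [hist_hist k.le_succ, hs] at h₁
  exact (h₂ _).2 h₁

instance nameSetoid : Setoid G.Name where
  r F F' := ∀ᶠ i in G.U, F.1 i = F'.1 i
  iseqv := ⟨fun _ => .of_forall fun _ => rfl, fun h => h.mono fun _ hi => hi.symm,
    fun h h' => (h.and h').mono fun _ hi => hi.1.trans hi.2⟩

instance namePrestructure : LN.Prestructure (nameSetoid (G := G)) where
  toStructure :=
    { funMap := fun f x => ⟨fun i => f fun j => (x j).1 i, by
        obtain ⟨k, g, hg⟩ := exists_stage Finset.univ x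
        exact ⟨k, fun σ => f fun j => g j σ, fun i =>
          congrArg f (funext fun j => hg j (Finset.mem_univ j) i)⟩⟩
      RelMap := fun R x => ∀ᶠ i in G.U, R fun j => (x j).1 i }
  fun_equiv {n f} x y h := by
    have : ∀ᶠ i in G.U, ∀ j, (x j).1 i = (y j).1 i := eventually_all.2 h
    exact this.mono fun i hi => congrArg f (funext hi)
  rel_equiv {n R} x y h := by
    have : ∀ᶠ i in G.U, ∀ j, (x j).1 i = (y j).1 i := eventually_all.2 h
    exact propext (eventually_congr (this.mono fun i hi => by rw [funext hi]))

variable (G) in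
/-- The model of all names modulo the ultrafilter. -/
abbrev Model : Type := Quotient (nameSetoid (G := G))

variable (G) in
/-- The interpretation of the symbol `X` in the model of names. -/
def XM : Set G.Model := {m | ∃ F : G.Name, ⟦F⟧ = m ∧ ∀ᶠ i in G.U, F.1 i ∈ G.X i}

theorem mk_mem_XM (F : G.Name) : (⟦F⟧ : G.Model) ∈ G.XM ↔ ∀ᶠ i in G.U, F.1 i ∈ G.X i := by
  refine ⟨fun ⟨F', h, hX⟩ => ?_, fun h => ⟨F, rfl, h⟩⟩
  have h' : ∀ᶠ i in G.U, F'.1 i = F.1 i := Quotient.exact h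
  filter_upwards [h', hX] with i h₁ h₂
  rwa [← h₁]

theorem relMap_mk {n : ℕ} (R : LN.Relations n) (x : Fin n → G.Name) :
    Structure.RelMap R (fun j => (⟦x j⟧ : G.Model)) ↔ ∀ᶠ i in G.U, R fun j => (x j).1 i :=
  relMap_quotient_mk' _ R x

theorem exists_realize_eq {n : ℕ} (t : Tm n) (v : ℕ → G.Name) (xs : Fin n → G.Name) :
    ∃ F : G.Name, (∀ i, F.1 i = t.realize (Sum.elim (fun a => (v a).1 i) fun j => (xs j).1 i)) ∧
      t.realize (Sum.elim (fun a => (⟦v a⟧ : G.Model)) fun j => ⟦xs j⟧) = ⟦F⟧ := by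
  induction t with
  | var x =>
    rcases x with x | x
    exacts [⟨v x, fun _ => rfl, rfl⟩, ⟨xs x, fun _ => rfl, rfl⟩]
  | func f ts ih =>
    choose F hF hF' using ih
    refine ⟨namePrestructure.toStructure.funMap f F, fun i => ?_, ?_⟩
    · exact congrArg f (funext fun j => hF j i)
    · rw [Term.realize_func, funext hF']
      exact funMap_quotient_mk' _ f F

variable (G) in
/-- The truth lemma for `φ`: truth in the model of names is truth in almost all of the structures
`(ℕ, X i)`. -/
def Los {n : ℕ} (φ : Fml n) : Prop :=
  ∀ (v : ℕ → G.Name) (xs : Fin n → G.Name),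
    φ.Realize G.XM (fun a => ⟦v a⟧) (fun j => ⟦xs j⟧) ↔
      ∀ᶠ i in G.U, φ.Realize (G.X i) (fun a => (v a).1 i) (fun j => (xs j).1 i)

theorem Los.neg {n : ℕ} {φ : Fml n} (h : G.Los φ) : G.Los φ.neg := by
  intro v xs
  simp only [realize_neg]
  rw [h v xs, Ultrafilter.eventually_not]

theorem Los.rel {n l : ℕ} (b : Bool) (R : LN.Relations l) (ts : Fin l → Tm n) :
    G.Los (.rel b R ts) := by
  have h : G.Los (.rel true R ts) := by
    intro v xs
    choose F hF hF' using fun j => exists_realize_eq (ts j) v xs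
    simp only [Realize, hF', ← hF]
    exact relMap_mk R F
  cases b
  exacts [h.neg, h]

theorem Los.mem {n : ℕ} (b : Bool) (t : Tm n) : G.Los (.mem b t) := by
  have h : G.Los (.mem true t) := by
    intro v xs
    obtain ⟨F, hF, hF'⟩ := exists_realize_eq t v xs
    simp only [Realize, hF', ← hF]
    exact mk_mem_XM F
  cases b
  exacts [h.neg, h]

theorem Los.and {n : ℕ} {φ ψ : Fml n} (hφ : G.Los φ) (hψ : G.Los ψ) : G.Los (.and φ ψ) := by
  intro v xs
  simp only [Realize]
  rw [hφ v xs, hψ v xs, eventually_and]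

theorem Los.or {n : ℕ} {φ ψ : Fml n} (hφ : G.Los φ) (hψ : G.Los ψ) : G.Los (.or φ ψ) := by
  intro v xs
  simp only [Realize]
  rw [hφ v xs, hψ v xs, Ultrafilter.eventually_or]

theorem mk_snoc {n : ℕ} (xs : Fin n → G.Name) (F : G.Name) :
    (Fin.snoc (α := fun _ => G.Model) (fun j => ⟦xs j⟧) ⟦F⟧ : Fin (n + 1) → G.Model) =
      fun j => ⟦(Fin.snoc (α := fun _ => G.Name) xs F : Fin (n + 1) → G.Name) j⟧ := by
  funext j
  refine Fin.lastCases ?_ (fun j => ?_) j <;> simp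

theorem val_snoc {n : ℕ} (xs : Fin n → G.Name) (F : G.Name) (i : G.I) :
    (Fin.snoc (α := fun _ => ℕ) (fun j => (xs j).1 i) (F.1 i) : Fin (n + 1) → ℕ) =
      fun j => ((Fin.snoc (α := fun _ => G.Name) xs F : Fin (n + 1) → G.Name) j).1 i := by
  funext j
  refine Fin.lastCases ?_ (fun j => ?_) j <;> simp

theorem Los.realize_snoc {n : ℕ} {φ : Fml (n + 1)} (hφ : G.Los φ) (v : ℕ → G.Name)
    (xs : Fin n → G.Name) (F : G.Name) :
    φ.Realize G.XM (fun a => ⟦v a⟧)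
        (Fin.snoc (α := fun _ => G.Model) (fun j => ⟦xs j⟧) ⟦F⟧ : Fin (n + 1) → G.Model) ↔
      ∀ᶠ i in G.U, φ.Realize (G.X i) (fun a => (v a).1 i)
        (Fin.snoc (α := fun _ => ℕ) (fun j => (xs j).1 i) (F.1 i) : Fin (n + 1) → ℕ) := by
  simp only [mk_snoc, val_snoc]
  exact hφ v _

/-- The truth lemma passes to an existential formula whose witnesses depend on a bounded part
of `X`. -/
theorem Los.ex {n : ℕ} {φ : Fml (n + 1)} (hφ : G.Los φ)
    (hloc : ∀ (v : ℕ → ℕ) (xs : Fin n → ℕ), ∃ N, ∀ m Y Z, AgreeBelow N Y Z →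
      (φ.Realize Y v (Fin.snoc (α := fun _ => ℕ) xs m : Fin (n + 1) → ℕ) ↔
        φ.Realize Z v (Fin.snoc (α := fun _ => ℕ) xs m : Fin (n + 1) → ℕ))) :
    G.Los (.ex φ) := by
  intro v xs
  constructor
  · rintro ⟨a, ha⟩
    obtain ⟨F, rfl⟩ := Quotient.exists_rep a
    exact ((hφ.realize_snoc v xs F).1 ha).mono fun i hi => ⟨_, hi⟩
  · intro h
    obtain ⟨k, f, hf⟩ := exists_stage (φ.fv.disjSum Finset.univ) (Sum.elim v xs)
    have hv : ∀ i a, a ∈ φ.fv → (v a).1 i = f (.inl a) (G.hist k i) := fun i a ha =>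
      hf (.inl a) (Finset.inl_mem_disjSum.2 ha) i
    have hxs : ∀ i, (fun j => (xs j).1 i) = fun j => f (.inr j) (G.hist k i) := fun i =>
      funext fun j => hf (.inr j) (Finset.inr_mem_disjSum.2 (Finset.mem_univ j)) i
    have hiff : ∀ i m, φ.Realize (G.X i) (fun a => (v a).1 i)
        (Fin.snoc (α := fun _ => ℕ) (fun j => (xs j).1 i) m : Fin (n + 1) → ℕ) ↔
        φ.Realize (G.X i) (fun a => f (.inl a) (G.hist k i))
          (Fin.snoc (α := fun _ => ℕ) (fun j => f (.inr j) (G.hist k i)) m : Fin (n + 1) → ℕ) :=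
      fun i m => by rw [← hxs]; exact realize_congr_fv _ _ _ (hv i)
    obtain ⟨F, hF⟩ := exists_name_local (G := G) k
      (fun σ m Y => φ.Realize Y (fun a => f (.inl a) σ)
        (Fin.snoc (α := fun _ => ℕ) (fun j => f (.inr j) σ) m : Fin (n + 1) → ℕ))
      (fun σ => hloc _ _) (h.mono fun i ⟨m, hm⟩ => ⟨m, (hiff i m).1 hm⟩)
    exact ⟨⟦F⟧, (hφ.realize_snoc v xs F).2 (hF.mono fun i hi => (hiff i _).2 hi)⟩

theorem los_of_XFree : ∀ {n : ℕ} (φ : Fml n), φ.XFree → G.Los φ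
  | _, .rel b R ts, _ => .rel b R ts
  | _, .and φ ψ, h => (los_of_XFree φ h.1).and (los_of_XFree ψ h.2)
  | _, .or φ ψ, h => (los_of_XFree φ h.1).or (los_of_XFree ψ h.2)
  | _, .ex φ, h => (los_of_XFree φ h).ex fun v xs =>
      ⟨0, fun m Y Z _ => XFree.realize_iff Y Z v _ (φ := φ) h⟩
  | _, .all φ, h => by
    have := ((los_of_XFree φ h).neg.ex fun v xs =>
      ⟨0, fun m Y Z _ => XFree.realize_iff Y Z v _ (XFree.neg (φ := φ) h)⟩).neg
    rwa [Fml.neg, Fml.neg_neg] at this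

theorem los_of_isDelta0 {n : ℕ} {φ : Fml n} (h : φ.IsDelta0) : G.Los φ := by
  have hbex : ∀ {n : ℕ} (t : Tm n) {φ : Fml (n + 1)}, φ.IsDelta0 → G.Los φ →
      G.Los (.ex (.and (.rel true (sym (· ≤ ·)) ![bvar (Fin.last n), liftTm t]) φ)) := by
    intro n t φ hΔ hφ
    refine ((Los.rel _ _ _).and hφ).ex fun v xs => ?_
    choose N hN using hΔ.exists_agreeBelow v
    refine ⟨(Finset.range (t.realize (Sum.elim v xs) + 1)).sup
      fun a => N (Fin.snoc (α := fun _ => ℕ) xs a), fun m Y Z hYZ => ?_⟩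
    rw [realize_and_le, realize_and_le]
    refine and_congr_right fun hm => hN _ Y Z (hYZ.mono ?_)
    exact Finset.le_sup (f := fun a => N (Fin.snoc (α := fun _ => ℕ) xs a))
      (Finset.mem_range.2 (Nat.lt_succ_of_le hm))
  induction h with
  | rel b R ts => exact .rel b R ts
  | mem b t => exact .mem b t
  | and _ _ ih₁ ih₂ => exact ih₁.and ih₂
  | or _ _ ih₁ ih₂ => exact ih₁.or ih₂
  | bex t h ih => exact hbex t h ih
  | ball t h ih =>
    have := (hbex t h.neg ih.neg).neg
    simpa only [Fml.neg, Fml.neg_neg, Bool.not_true] using this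

/-! ### The axioms hold in the model of names -/

variable (G) in
theorem realize_eq (x : Fin 2 → G.Model) :
    Structure.RelMap (sym (· = ·)) x ↔ x 0 = x 1 := by
  obtain ⟨F, rfl⟩ : ∃ F : Fin 2 → G.Name, x = fun j => ⟦F j⟧ :=
    ⟨fun j => (x j).out, funext fun j => (Quotient.out_eq _).symm⟩
  rw [relMap_mk]
  exact (Quotient.eq (r := nameSetoid (G := G))).symm

theorem realize_of_mem_ThN {φ : Fml 0} (h : φ ∈ ThN) (v : ℕ → G.Model) :
    φ.Realize G.XM v ![] := by
  obtain ⟨hX, hfv, -, htrue⟩ := h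
  obtain ⟨w, rfl⟩ : ∃ w : ℕ → G.Name, v = fun a => ⟦w a⟧ :=
    ⟨fun a => (v a).out, funext fun a => (Quotient.out_eq _).symm⟩
  have := (los_of_XFree (G := G) φ hX w ![]).2 (.of_forall fun i => by
    rw [hX.realize_iff _ ∅, realize_congr_fv (w := fun _ => 0) _ _ _ (by simp [hfv]),
      Subsingleton.elim (fun j => _) ![] ]
    exact htrue)
  rwa [Subsingleton.elim (fun j => _) ![] ] at this

theorem realize_ex_snoc {ψ : Fml 2} (hψ : ψ.IsDelta0) (v : ℕ → G.Name) (F : G.Name) :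
    (Fml.ex ψ).Realize G.XM (fun a => ⟦v a⟧) (fun _ => ⟦F⟧) ↔
      ∃ F' : G.Name, ∀ᶠ i in G.U, ψ.Realize (G.X i) (fun a => (v a).1 i)
        (Fin.snoc (α := fun _ => ℕ) (fun _ : Fin 1 => F.1 i) (F'.1 i) : Fin 2 → ℕ) := by
  have h := (los_of_isDelta0 (G := G) hψ).realize_snoc v fun _ => F
  constructor
  · rintro ⟨a, ha⟩
    obtain ⟨F', rfl⟩ := Quotient.exists_rep a
    exact ⟨F', (h F').1 ha⟩
  · rintro ⟨F', hF'⟩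
    exact ⟨⟦F'⟧, (h F').2 hF'⟩

/-- Induction holds since almost all sequences decide it: whichever of the three cases occurs,
the numbers in question are names, and `X` is a set admitted by the deciding condition. -/
theorem realize_indFml {φ : Fml 1} (h : φ.IsPSigma 1) (v : ℕ → G.Model) :
    (indFml φ).Realize G.XM v ![] := by
  obtain ⟨ψ, hψ, rfl⟩ := IsPSigma.exists_eq_ex h
  obtain ⟨w, rfl⟩ : ∃ w : ℕ → G.Name, v = fun a => ⟦w a⟧ :=
    ⟨fun a => (v a).out, funext fun a => (Quotient.out_eq _).symm⟩
  rw [indFml, Realize, realize_neg, ← imp_iff_not_or]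
  rintro ⟨h₀, hstep⟩ a
  rw [realize_inst] at h₀
  obtain ⟨T, rfl⟩ := Quotient.exists_rep a
  rw [snoc_empty, realize_ex_snoc hψ]
  have hsucc : ∀ F F' : G.Name, (∀ᶠ i in G.U, F'.1 i = F.1 i + 1) →
      (Fml.ex ψ).Realize G.XM (fun a => ⟦w a⟧) (fun _ => ⟦F⟧) →
      (Fml.ex ψ).Realize G.XM (fun a => ⟦w a⟧) (fun _ => ⟦F'⟧) := by
    intro F F' hF hφ
    have := hstep ⟦F⟧
    rw [Realize, snoc_empty, realize_neg, ← imp_iff_not_or, shift, realize_subst] at this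
    obtain ⟨F'', hF'', h''⟩ := exists_realize_eq (G := G) (tsucc (bvar 0) : Tm 1) w fun _ => F
    have heq : (⟦F''⟧ : G.Model) = ⟦F'⟧ :=
      Quotient.sound (hF.mono fun i hi => (hF'' i).trans hi.symm)
    rw [← heq, ← h'']
    exact this hφ
  obtain ⟨Z, hZ, hZ'⟩ := exists_realize_eq (G := G) (tzero : Tm 0) w ![]
  have hZ0 : (fun _ : Fin 1 => (tzero : Tm 0).realize
      (Sum.elim (fun a => (⟦w a⟧ : G.Model)) ![])) = fun _ => ⟦Z⟧ := by
    rw [← hZ', Subsingleton.elim (fun j => _) ![] ]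
  rw [hZ0, realize_ex_snoc hψ] at h₀
  -- all parameters are computed at a common stage `k`
  obtain ⟨k, f, hf⟩ := exists_stage (insert none (ψ.fv.map .some)) (fun o : Option ℕ => o.elim T w)
  have hT : ∀ i, T.1 i = f none (G.hist k i) := hf none (Finset.mem_insert_self _ _)
  have hiff : ∀ i (Y : Set ℕ) (xs : Fin 2 → ℕ), ψ.Realize Y (fun a => (w a).1 i) xs ↔
      ψ.Realize Y (fun a => f (some a) (G.hist k i)) xs := fun i Y xs =>
    realize_congr_fv Y xs ψ fun a ha => hf (some a)
      (Finset.mem_insert_of_mem (Finset.mem_map_of_mem _ ha)) i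
  have hgen := G.generic (Task.induction
    (fun σ x y Y => ψ.Realize Y (fun a => f (some a) σ)
      (Fin.snoc (α := fun _ => ℕ) (fun _ : Fin 1 => x) y : Fin 2 → ℕ))
    (fun σ => hψ.realize_local _) (f none)) k
  have hs : ∀ i, G.hist (k + 1) i (k + 1) = G.s i (k + 1) := fun i => trunc_self _ _
  obtain hc | hgen := Ultrafilter.eventually_or.1 hgen
  · obtain ⟨F, hF⟩ := h₀
    obtain ⟨i, h₁, h₂⟩ := (hc.and hF).exists
    rw [hiff, hZ] at h₂
    exact absurd h₂ (h₁ _ (G.ext_X i _) _)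
  obtain hc | hc := Ultrafilter.eventually_or.1 hgen
  · -- a single name for the pair of the stage at which the induction step fails and a witness
    obtain ⟨F, hF⟩ := exists_name (G := G) (k + 1)
      (fun σ p => (∀ Y, (σ (k + 1)).Ext Y → ψ.Realize Y (fun a => f (some a) (trunc k σ))
          (Fin.snoc (α := fun _ => ℕ) (fun _ : Fin 1 => p.unpair.1) p.unpair.2 : Fin 2 → ℕ)) ∧
        ∀ Y, (σ (k + 1)).Ext Y → ∀ y, ¬ ψ.Realize Y (fun a => f (some a) (trunc k σ))
          (Fin.snoc (α := fun _ => ℕ) (fun _ : Fin 1 => p.unpair.1 + 1) y : Fin 2 → ℕ))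
      (hc.mono fun i ⟨a, ⟨y, hy⟩, ha⟩ => ⟨Nat.pair a y, by
        rw [hs, hist_hist k.le_succ, Nat.unpair_pair]; exact ⟨hy, ha⟩⟩)
    simp only [hs, hist_hist k.le_succ, ← hiff] at hF
    have h₁ : (Fml.ex ψ).Realize G.XM (fun a => ⟦w a⟧)
        (fun _ => ⟦F.map fun p => p.unpair.1⟧) :=
      (realize_ex_snoc hψ _ _).2 ⟨F.map fun p => p.unpair.2,
        hF.mono fun i hi => hi.1 _ (G.ext_X i _)⟩
    obtain ⟨F', hF'⟩ := (realize_ex_snoc hψ _ _).1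
      (hsucc _ (F.map fun p => p.unpair.1 + 1) (.of_forall fun _ => rfl) h₁)
    obtain ⟨i, h₁, h₂⟩ := (hF.and hF').exists
    exact absurd h₂ (h₁.2 _ (G.ext_X i _) _)
  · obtain ⟨F, hF⟩ := exists_name (G := G) (k + 1)
      (fun σ y => ∀ Y, (σ (k + 1)).Ext Y → ψ.Realize Y (fun a => f (some a) (trunc k σ))
        (Fin.snoc (α := fun _ => ℕ) (fun _ : Fin 1 => f none (trunc k σ)) y : Fin 2 → ℕ))
      (hc.mono fun i hi => by rw [hs, hist_hist k.le_succ]; exact hi)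
    simp only [hs, hist_hist k.le_succ, ← hiff, ← hT] at hF
    exact ⟨F, hF.mono fun i hi => hi _ (G.ext_X i _)⟩

/-- The set `X` of the model of names has an element, but no least one. -/
theorem not_realize_TI (v : ℕ → G.Model) : ¬ ∃ φ ∈ TI r, φ.Realize G.XM v ![] := by
  rintro ⟨φ, hφ, h⟩
  obtain rfl | hφ := Finset.mem_insert.1 hφ
  · obtain ⟨F, hF⟩ := exists_name (G := G) 0 (fun σ m => m ∈ (σ 0).P)
      (.of_forall fun i => G.nonempty i)
    have := h ⟦F⟧
    rw [snoc_empty] at this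
    exact this ((mk_mem_XM F).2 (hF.mono fun i hi => (G.ext_X i 0).1 hi))
  · obtain rfl := Finset.mem_singleton.1 hφ
    obtain ⟨a, ha⟩ := h
    rw [snoc_empty] at ha
    replace ha := (realize_isMinFml r _ _ a).1 ha
    obtain ⟨F, rfl⟩ := Quotient.exists_rep a
    have hF := (mk_mem_XM F).1 (ha ⟦F⟧).1
    obtain ⟨k, f, hf⟩ := F.2
    have hdesc : ∀ᶠ i in G.U, ∃ x, x ∈ (G.s i (k + 1)).P ∧ r x (F.1 i) := by
      filter_upwards [G.generic (Task.descend f) k, hF] with i hi hX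
      obtain ⟨h₁, h₂⟩ | ⟨x, hx, hxr⟩ := hi
      · rw [hf] at hX
        exact absurd (((G.ext_X i (k + 1)).agreeBelow _ h₂).1 hX) h₁
      · exact ⟨x, hx, (hf i).symm ▸ hxr⟩
    obtain ⟨F', hF'⟩ := exists_name (G := G) (k + 1)
      (fun σ x => x ∈ (σ (k + 1)).P ∧ r x (f (trunc k σ))) (hdesc.mono fun i hi => by
        rw [hist_hist k.le_succ, ← hf]
        simpa only [hist, trunc_self] using hi)
    have hmem : (⟦F'⟧ : G.Model) ∈ G.XM := (mk_mem_XM F').2 (hF'.mono fun i hi =>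
      (G.ext_X i (k + 1)).1 (by simpa only [hist, trunc_self] using hi.1))
    have hrel : Structure.RelMap (sym r) ![(⟦F'⟧ : G.Model), ⟦F⟧] := by
      have h2 : ![(⟦F'⟧ : G.Model), ⟦F⟧] = fun j => ⟦(![F', F] : Fin 2 → G.Name) j⟧ := by
        funext j
        fin_cases j <;> rfl
      rw [h2, relMap_mk]
      exact hF'.mono fun i hi => by
        have := hi.2
        rw [hist_hist k.le_succ, ← hf] at this
        exact this
    exact (ha ⟦F'⟧).2.elim (fun h => h hmem) fun h => h hrel

theorem not_proves (G : GenericFamily r) : ¬ Proves (ISigma 1) (TI r) := by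
  intro h
  refine not_realize_TI (G := G) (fun _ => ⟦⟨fun _ => 0, 0, fun _ => 0, fun _ => rfl⟩⟧)
    (h G.Model G.XM G.realize_eq ?_ _)
  rintro φ (hφ | ⟨φ, hφ, rfl⟩) v
  exacts [realize_of_mem_ThN hφ v, realize_indFml hφ v]

end GenericFamily

end

end ArithX

theorem mainTheorem3 (r : ℕ → ℕ → Prop) [IsWellOrder ℕ r] :
    (∀ (h : ℕ) (π : ArithX.Derivation 1 (ArithX.TI r)),
      Ordinal.omega0 ^ ((h : Ordinal) + 1) + Ordinal.omega0 < Ordinal.type r → h < π.height) ∧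
    (Ordinal.omega0 ^ Ordinal.omega0 ≤ Ordinal.type r →
      IsEmpty (ArithX.Derivation 1 (ArithX.TI r)) ∧
        ¬ ArithX.Proves (ArithX.ISigma 1) (ArithX.TI r)) := by
  refine ⟨fun h π hr => π.lt_height ?_, fun hr => ?_⟩
  · refine lt_of_le_of_lt ?_ hr
    rw [← Ordinal.opow_natCast, Nat.cast_succ]
    exact le_self_add
  · have hlt : ∀ H : ℕ, Ordinal.omega0 ^ H < Ordinal.type r := fun H => by
      refine lt_of_lt_of_le ?_ hr
      rw [← Ordinal.opow_natCast]
      exact (Ordinal.opow_lt_opow_iff_right Ordinal.one_lt_omega0).2 (Ordinal.natCast_lt_omega0 H)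
    obtain ⟨G⟩ := ArithX.GenericFamily.nonempty_of_forall_lt hlt
    exact ⟨⟨fun π => (π.lt_height (hlt (π.height + 1))).false⟩, G.not_proves⟩
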